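/- Fix an integer $m\ge 1$. For $n\ge 1$ let $w_1,\dots,w_{mn+1}$ be independent exponential random variables with mean $1$, let $W_k=w_1+\dots+w_k$ ($W_0=0$) and $R_k=W_k/W_{mn+1}$ ($R_0=0$). Conditionally on $w_1,\dots,w_{mn+1}$ let $\ell_1,\dots,\ell_{mn}$ be independent, $\ell_k$ having density $\frac{1}{2\sqrt{R_kx}}$ on $(0,R_k]$. The Bollobás–Riordan multigraph $G_m^n$ on the vertex set $\{1,\dots,n\}$ has the $mn$ chords $(\ell_k,R_k)$ as its edges, where vertex $j$ consists of all the endpoints in $(R_{m(j-1)},R_{mj}]$. Let $D(j)$ be the degree of vertex $j$, i.e. the number of the $2mn$ chord endpoints that belong to vertex $j$ (so a loop counts twice), and let $$\mathcal D(j)=2(mn)^{1/2}\bigl(W_{mj}^{1/2}-W_{m(j-1)}^{1/2}\bigr).$$ Let $0<a<\frac{m}{m+2}$, $j_n=\lfloor n^a\rfloor$, $0<\delta<\frac14\bigl(1-\frac{a(m+2)}{m}\bigr)$ and $b<\frac12\bigl(1-\frac{a(m+2)}{m}\bigr)$. **(1)** There is a constant $C=C(m,a,\delta)>0$ such that for every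 $$\Delta<\min\Bigl(\frac{1-a}{2}-\delta;\ \frac m2\Bigl(1-\frac{a(m+2)}{m}\Bigr)-2m\delta\Bigr)$$ and all sufficiently large $n$, $$\mathbb P\Bigl(|D(j)-\mathcal D(j)|\le C n^{-\delta}\,\mathcal D(j)\ \text{ for all } 1\le j\le j_n\Bigr)\ \ge\ 1-n^{-\Delta}.$$ **(2)** For every $\Delta$ as in (1), every $\Delta_1<\min\Bigl(\Delta;\ m\Bigl[\frac12\Bigl(1-\frac{a(m+2)}{m}\Bigr)-b\Bigr]\Bigr)$ and all sufficiently large $n$, $$\mathbb P\Bigl(\min_{1\le j\le j_n}D(j)>n^b\Bigr)\ \ge\ 1-n^{-\Delta_1}.$$ **(3)** Consequently, for all $0<\varepsilon'<\varepsilon<\frac{m}{m+2}$, with probability tending to $1$ as $n\to\infty$, each of the first $\bigl\lfloor n^{\frac{m}{m+2}-\varepsilon}\bigr\rfloor$ vertices of $G_m^n$ has degree at least $n^{\varepsilon'(m+2)/(2m)}$. -/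

import Mathlib

open MeasureTheory ProbabilityTheory Filter Topology Set
open scoped ENNReal

noncomputable section

namespace PairingModel

/-- The partial sum `W_j = w_1 + ⋯ + w_j` (the coordinate of `w` with index `i` is `w_{i+1}`);
in particular `W_0 = 0`. -/
def partialSum {N : ℕ} (w : Fin (N + 1) → ℝ) (j : ℕ) : ℝ :=
  ∑ i : Fin (N + 1), if (i : ℕ) < j then w i else 0

/-- The right endpoint `R_k = W_k / W_{N+1}`; in particular `R_0 = 0`. -/
def rightEnd {N : ℕ} (w : Fin (N + 1) → ℝ) (k : ℕ) : ℝ :=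
  partialSum w k / partialSum w (N + 1)

/-- The density `x ↦ 1 / (2 √(r x))` on `(0, r]`, extended by zero. -/
def leftDensity (r x : ℝ) : ℝ≥0∞ :=
  if 0 < x ∧ x ≤ r then ENNReal.ofReal (1 / (2 * √(r * x))) else 0

/-- The conditional law of the left endpoint of a chord whose right endpoint is `r`
(a probability measure for `r > 0`). -/
def leftLaw (r : ℝ) : Measure ℝ := volume.withDensity (leftDensity r)

lemma measurable_leftDensity : Measurable (Function.uncurry leftDensity) := by
  unfold leftDensity Function.uncurry
  refine Measurable.ite ?_ (by fun_prop) measurable_const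
  exact (measurableSet_lt measurable_const measurable_snd).inter
    (measurableSet_le measurable_snd measurable_fst)

lemma measurable_leftLaw : Measurable leftLaw := by
  refine Measure.measurable_of_measurable_coe _ fun s hs => ?_
  simp only [leftLaw, withDensity_apply _ hs]
  exact measurable_leftDensity.lintegral_prod_right'

lemma leftLaw_of_nonpos {r : ℝ} (hr : r ≤ 0) : leftLaw r = 0 := by
  have : leftDensity r = 0 := by
    funext x
    simp only [leftDensity, Pi.zero_apply, ite_eq_right_iff]
    intro h
    linarith [h.1, h.2]
  rw [leftLaw, this, withDensity_zero]

lemma isProbabilityMeasure_leftLaw {r : ℝ} (hr : 0 < r) : IsProbabilityMeasure (leftLaw r) := by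
  constructor
  have hint : IntervalIntegrable (fun x : ℝ => x ^ (-(1 / 2) : ℝ)) volume 0 r :=
    intervalIntegral.intervalIntegrable_rpow' (by norm_num)
  have h1 : leftDensity r = (Ioc 0 r).indicator
      (fun x => ENNReal.ofReal ((1 / (2 * √r)) * x ^ (-(1 / 2) : ℝ))) := by
    funext x
    by_cases hx : x ∈ Ioc 0 r
    · rw [indicator_of_mem hx, leftDensity, if_pos (mem_Ioc.1 hx), Real.sqrt_mul hr.le,
        Real.rpow_neg hx.1.le, ← Real.sqrt_eq_rpow]
      congr 1
      field_simp
    · rw [indicator_of_notMem hx, leftDensity, if_neg (fun h => hx (mem_Ioc.2 h))]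
  rw [leftLaw, withDensity_apply _ MeasurableSet.univ, Measure.restrict_univ, h1,
    lintegral_indicator measurableSet_Ioc,
    ← ofReal_integral_eq_lintegral_ofReal]
  · rw [← intervalIntegral.integral_of_le hr.le, intervalIntegral.integral_const_mul,
      integral_rpow (Or.inl (by norm_num))]
    have : (-(1 / 2) + 1 : ℝ) = 1 / 2 := by norm_num
    rw [this, ← Real.sqrt_eq_rpow, Real.zero_rpow (by norm_num)]
    have h0 : √r ≠ 0 := (Real.sqrt_pos.2 hr).ne'
    rw [ENNReal.ofReal_eq_one]
    field_simp
    norm_num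
  · exact ((intervalIntegrable_iff_integrableOn_Ioc_of_le hr.le).1 hint).const_mul _
  · filter_upwards [ae_restrict_mem measurableSet_Ioc] with x hx
    have := hx.1
    positivity

instance isFiniteMeasure_leftLaw (r : ℝ) : IsFiniteMeasure (leftLaw r) := by
  rcases le_or_gt r 0 with hr | hr
  · rw [leftLaw_of_nonpos hr]; infer_instance
  · have := isProbabilityMeasure_leftLaw hr; infer_instance

lemma measurable_partialSum {N : ℕ} (j : ℕ) :
    Measurable fun w : Fin (N + 1) → ℝ => partialSum w j := by
  unfold partialSum
  refine Finset.measurable_sum _ fun i _ => ?_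
  split_ifs <;> fun_prop

lemma measurable_rightEnd {N : ℕ} (k : ℕ) :
    Measurable fun w : Fin (N + 1) → ℝ => rightEnd w k :=
  (measurable_partialSum k).div (measurable_partialSum (N + 1))

/-- The conditional law of the left endpoints `(ℓ_1, …, ℓ_N)` given `w`: they are independent,
and `ℓ_k` has density `1 / (2 √(R_k x))` on `(0, R_k]`.
The coordinate with index `k` is `ℓ_{k+1}`. -/
def leftKernel (N : ℕ) : Kernel (Fin (N + 1) → ℝ) (Fin N → ℝ) where
  toFun w := Measure.pi fun k : Fin N => leftLaw (rightEnd w (k + 1))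
  measurable' := by
    refine Measurable.measure_of_isPiSystem generateFrom_pi.symm isPiSystem_pi ?_ ?_
    · rintro _ ⟨s, hs, rfl⟩
      simp only [Measure.pi_pi]
      exact Finset.measurable_prod _ fun k _ =>
        (Measure.measurable_coe (show MeasurableSet (s k) from hs k (mem_univ k))).comp
          (measurable_leftLaw.comp (measurable_rightEnd _))
    · simp only [Measure.pi_univ]
      exact Finset.measurable_prod _ fun k _ =>
        (Measure.measurable_coe MeasurableSet.univ).comp
          (measurable_leftLaw.comp (measurable_rightEnd _))

lemma leftKernel_apply (N : ℕ) (w : Fin (N + 1) → ℝ) :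
    leftKernel N w = Measure.pi fun k : Fin N => leftLaw (rightEnd w (k + 1)) := rfl

instance isFiniteKernel_leftKernel (N : ℕ) : IsFiniteKernel (leftKernel N) := by
  refine ⟨⟨1, ENNReal.one_lt_top, fun w => ?_⟩⟩
  rw [leftKernel_apply, Measure.pi_univ]
  refine Finset.prod_le_one' fun k _ => ?_
  rcases le_or_gt (rightEnd w (k + 1)) 0 with hr | hr
  · simp [leftLaw_of_nonpos hr]
  · have := isProbabilityMeasure_leftLaw hr
    exact prob_le_one

/-- The joint law of `(w, ℓ)`: the coordinates `w_1, …, w_{N+1}` are independent exponentials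
with mean `1`, and given `w` the left endpoints are distributed according to `leftKernel`. -/
def chordLaw (N : ℕ) : Measure ((Fin (N + 1) → ℝ) × (Fin N → ℝ)) :=
  (Measure.pi fun _ : Fin (N + 1) => expMeasure 1) ⊗ₘ leftKernel N

lemma ae_pos_weights (N : ℕ) :
    ∀ᵐ w ∂(Measure.pi fun _ : Fin (N + 1) => expMeasure 1), ∀ i, 0 < w i := by
  have := isProbabilityMeasure_expMeasure (r := 1) one_pos
  rw [ae_all_iff]
  intro i
  have h : ∀ᵐ x ∂(expMeasure 1), 0 < x := by
    rw [ae_iff]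
    have h2 : {x : ℝ | ¬ 0 < x} = Iic 0 := by ext; simp
    rw [h2, expMeasure, gammaMeasure, withDensity_apply _ measurableSet_Iic,
      ← setLIntegral_congr (Iio_ae_eq_Iic (a := (0 : ℝ)))]
    exact lintegral_gammaPDF_of_nonpos le_rfl
  exact (Measure.quasiMeasurePreserving_eval (fun _ : Fin (N + 1) => expMeasure 1) i).ae h

instance isProbabilityMeasure_chordLaw (N : ℕ) : IsProbabilityMeasure (chordLaw N) := by
  have := isProbabilityMeasure_expMeasure (r := 1) one_pos
  constructor
  rw [chordLaw, Measure.compProd_apply MeasurableSet.univ]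
  have h : ∀ᵐ w ∂(Measure.pi fun _ : Fin (N + 1) => expMeasure 1),
      leftKernel N w (Prod.mk w ⁻¹' univ) = 1 := by
    filter_upwards [ae_pos_weights N] with w hw
    have hW : ∀ k : ℕ, 0 < partialSum w (k + 1) := fun k => by
      refine Finset.sum_pos' (fun i _ => ?_) ⟨0, Finset.mem_univ _, by simpa using hw 0⟩
      split_ifs
      exacts [(hw i).le, le_rfl]
    have (k : Fin N) : IsProbabilityMeasure (leftLaw (rightEnd w (k + 1))) :=
      isProbabilityMeasure_leftLaw (div_pos (hW k) (hW N))
    rw [preimage_univ, leftKernel_apply, measure_univ]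
  rw [lintegral_congr_ae h]
  simp

/-- The points of `(0, 1]` that make up vertex `i` (`1 ≤ i ≤ N`) of the graph `G_1^N` of the
diagram with chords `(ℓ_k, R_k)`: those after `R_{i-1}`, up to and including `R_i`. -/
def chordVertex {N : ℕ} (w : Fin (N + 1) → ℝ) (i : ℕ) : Set ℝ :=
  Ioc (rightEnd w (i - 1)) (rightEnd w i)

/-- The points that make up vertex `j` (`1 ≤ j ≤ n`) of `G_m^n`: the `j`-th block of `m`
consecutive vertices of `G_1^{mn}`. -/
def blockVertex (m : ℕ) {N : ℕ} (w : Fin (N + 1) → ℝ) (j : ℕ) : Set ℝ :=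
  ⋃ i ∈ Finset.Icc (m * (j - 1) + 1) (m * j), chordVertex w i

/-- The degree `D(j)` of vertex `j` in the multigraph `G_m^n`, whose edges are the `mn` chords:
each chord contributes each of its two endpoints that belongs to vertex `j`
(so a loop counts twice). -/
def degree (m : ℕ) {N : ℕ} (x : (Fin (N + 1) → ℝ) × (Fin N → ℝ)) (j : ℕ) : ℕ :=
  ∑ k : Fin N, ((blockVertex m x.1 j).indicator (fun _ => 1) (x.2 k) +
    (blockVertex m x.1 j).indicator (fun _ => 1) (rightEnd x.1 (k + 1)))

/-- `𝒟(j) = 2 (mn)^{1/2} (W_{mj}^{1/2} - W_{m(j-1)}^{1/2})`. -/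
def approxDegree (m n : ℕ) (w : Fin (m * n + 1) → ℝ) (j : ℕ) : ℝ :=
  2 * √((m : ℝ) * n) * (√(partialSum w (m * j)) - √(partialSum w (m * (j - 1))))

end PairingModel

end

/-! The argument conditions on the weights. Given `w`, the left endpoints are independent. A chord
with right endpoint `R_k` beyond vertex `j` has its left endpoint in that vertex with probability
`(√W_{mj} - √W_{m(j-1)}) / √W_k`, because the law on `(0, R_k]` has distribution function `√(x /
R_k)`. Since `W_k ≈ k`, summing over `mj ≤ k ≤ mn` gives about `2 √(mn) (√W_{mj} - √W_{m(j-1)}) =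
𝒟(j)`. At most `m` right endpoints are added to this, so a Chernoff bound keeps `D(j)` within `5 θ
𝒟(j)` of `𝒟(j)`, for `θ = n ^ (-δ)`, as soon as `θ² 𝒟(j)` is a positive power of `n`.

Two kinds of exceptional weights have to be excluded. For the mean, `|W_k - k| < √(q k)` is required
for `k ≥ 4q`, and `w_1 ≥ y` controls the few smaller `k` (`concentratedWeights`). For the lower
bound on `𝒟(j)`, all weights are at most `q` and every block of `m` weights contains one that is at
least `x` (`regularWeights`). Then `W_{mj} - W_{m(j-1)} ≥ x` and `W_{mj} ≤ m j q`, which gives `𝒟(j)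
≥ √(n / (A q)) x` for `j ≤ A` (`le_approxDegree`). A block fails with probability at most `x ^ m`,
and the union over `j ≤ A = n ^ a` produces the rate `m/2 (1 - a (m+2)/m) - 2mδ`.

The finite bound `chordLaw_exists_abs_degree_sub_gt_le` collects these estimates. Part (1) takes `q
= n ^ η` with small `η` and the other parameters as powers of `n`. Part (2) combines (1) with a
lower bound on `𝒟` at level `n ^ (b + η)`, and part (3) is a case of (2). -/

namespace PairingModel

/-! ### Chernoff bounds -/

/-- A two-sided Chernoff bound for a random variable whose moment generating function near `0` is
dominated by `exp (M (s + s ^ 2))`. -/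
theorem measureReal_abs_sub_ge_le_of_mgf_le {Ω : Type*} [MeasurableSpace Ω] {μ : Measure Ω}
    [IsFiniteMeasure μ] {Z : Ω → ℝ} {M ε : ℝ} (hε : 0 ≤ ε) (hε1 : ε ≤ 1)
    (hint : ∀ s : ℝ, |s| ≤ 1 / 2 → Integrable (fun ω => Real.exp (s * Z ω)) μ)
    (hmgf : ∀ s : ℝ, |s| ≤ 1 / 2 → mgf Z μ s ≤ Real.exp (M * (s + s ^ 2))) :
    μ.real {ω | ε * M ≤ |Z ω - M|} ≤ 2 * Real.exp (-(ε ^ 2 * M / 4)) := by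
  -- The exponent `M (s ^ 2 - ε s)` of the upper tail is minimal at `s = ε / 2`; the lower tail uses
  -- `-ε / 2`.
  have hs1 : |ε / 2| ≤ 1 / 2 := by rw [abs_of_nonneg (by linarith)]; linarith
  have hs2 : |-(ε / 2)| ≤ 1 / 2 := by rwa [abs_neg]
  have h1 := measure_ge_le_exp_mul_mgf (μ := μ) (X := Z) (M + ε * M) (t := ε / 2) (by linarith)
    (hint _ hs1)
  have h2 := measure_le_le_exp_mul_mgf (μ := μ) (X := Z) (M - ε * M) (t := -(ε / 2)) (by linarith)
    (hint _ hs2)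
  have e1 : Real.exp (-(ε / 2) * (M + ε * M)) * mgf Z μ (ε / 2)
      ≤ Real.exp (-(ε ^ 2 * M / 4)) := by
    refine (mul_le_mul_of_nonneg_left (hmgf _ hs1) (Real.exp_pos _).le).trans_eq ?_
    rw [← Real.exp_add]; congr 1; ring
  have e2 : Real.exp (-(-(ε / 2)) * (M - ε * M)) * mgf Z μ (-(ε / 2))
      ≤ Real.exp (-(ε ^ 2 * M / 4)) := by
    refine (mul_le_mul_of_nonneg_left (hmgf _ hs2) (Real.exp_pos _).le).trans_eq ?_
    rw [← Real.exp_add]; congr 1; ring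
  have hsub : {ω | ε * M ≤ |Z ω - M|} ⊆ {ω | M + ε * M ≤ Z ω} ∪ {ω | Z ω ≤ M - ε * M} := by
    intro ω hω
    rcases le_abs.1 (show ε * M ≤ |Z ω - M| from hω) with h | h
    · left; change M + ε * M ≤ Z ω; linarith
    · right; change Z ω ≤ M - ε * M; linarith
  calc μ.real {ω | ε * M ≤ |Z ω - M|}
      ≤ μ.real {ω | M + ε * M ≤ Z ω} + μ.real {ω | Z ω ≤ M - ε * M} :=
        (measureReal_mono hsub).trans (measureReal_union_le _ _)
    _ ≤ _ := by linarith

/-- The Chernoff bound for a sum of functions of independent coordinates. -/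
theorem pi_measureReal_abs_sum_sub_ge_le {ι : Type*} [Fintype ι] (ν : ι → Measure ℝ)
    [∀ i, IsProbabilityMeasure (ν i)] (f : ι → ℝ → ℝ) (c : ι → ℝ)
    (hint : ∀ i, ∀ s : ℝ, |s| ≤ 1 / 2 → Integrable (fun x => Real.exp (s * f i x)) (ν i))
    (hmgf : ∀ i, ∀ s : ℝ, |s| ≤ 1 / 2 → mgf (f i) (ν i) s ≤ Real.exp (c i * (s + s ^ 2)))
    {ε : ℝ} (hε : 0 ≤ ε) (hε1 : ε ≤ 1) :
    (Measure.pi ν).real {x | ε * ∑ i, c i ≤ |∑ i, f i (x i) - ∑ i, c i|}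
      ≤ 2 * Real.exp (-(ε ^ 2 * (∑ i, c i) / 4)) := by
  have hexp (s : ℝ) : (fun x : ι → ℝ => Real.exp (s * ∑ i, f i (x i)))
      = fun x => ∏ i, Real.exp (s * f i (x i)) := by
    funext x; rw [Finset.mul_sum, Real.exp_sum]
  refine measureReal_abs_sub_ge_le_of_mgf_le hε hε1 (fun s hs => ?_) (fun s hs => ?_)
  · rw [hexp]
    exact Integrable.fintype_prod (f := fun i x => Real.exp (s * f i x)) fun i => hint i s hs
  · rw [mgf, hexp, integral_fintype_prod_eq_prod (𝕜 := ℝ) (fun i x => Real.exp (s * f i x)),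
      Finset.sum_mul, Real.exp_sum]
    exact Finset.prod_le_prod (fun i _ => integral_nonneg fun x => (Real.exp_pos _).le)
      fun i _ => hmgf i s hs

theorem exp_le_one_add_add_sq {s : ℝ} (hs : |s| ≤ 1 / 2) : Real.exp s ≤ 1 + (s + s ^ 2) := by
  have h := Real.abs_exp_sub_one_sub_id_le (x := s) (by linarith)
  linarith [(abs_le.1 h).2]

/-- The left side is the moment generating function of a mean-one exponential, so this puts the
weights under the same Chernoff bound as indicators. For `s < 0` it follows from `(1 - s)(1 + s +
s²) = 1 - s³ ≥ 1`; for `s ≥ 0` the quadratic term of the exponential series compensates `-s³`. -/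
theorem inv_one_sub_le_exp {s : ℝ} (hs : |s| ≤ 1 / 2) : (1 - s)⁻¹ ≤ Real.exp (s + s ^ 2) := by
  obtain ⟨h1, h2⟩ := abs_le.1 hs
  rw [inv_le_iff_one_le_mul₀' (by linarith)]
  rcases lt_or_ge s 0 with h | h
  · have h3 := mul_le_mul_of_nonneg_left (Real.add_one_le_exp (s + s ^ 2))
      (show 0 ≤ 1 - s by linarith)
    nlinarith [pow_pos (neg_pos.2 h) 3]
  · have h3 := mul_le_mul_of_nonneg_left
      (Real.quadratic_le_exp_of_nonneg (x := s + s ^ 2) (by positivity))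
      (show 0 ≤ 1 - s by linarith)
    have h4 := mul_nonneg (sq_nonneg s) (sub_nonneg.2 h2)
    have h5 := mul_nonneg h h4
    have h6 := mul_nonneg (sq_nonneg s) h4
    nlinarith [mul_nonneg h h6]

/-- With `p = ν.real B`, the left side is `1 + p (exp s - 1) ≤ 1 + p (s + s²)`. -/
theorem mgf_indicator_le {ν : Measure ℝ} [IsProbabilityMeasure ν] {B : Set ℝ}
    (hB : MeasurableSet B) {s : ℝ} (hs : |s| ≤ 1 / 2) :
    mgf (B.indicator fun _ => (1 : ℝ)) ν s ≤ Real.exp (ν.real B * (s + s ^ 2)) := by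
  have h1 : (fun x => Real.exp (s * B.indicator (fun _ => (1 : ℝ)) x))
      = fun x => 1 + B.indicator (fun _ => Real.exp s - 1) x := by
    funext x
    by_cases hx : x ∈ B <;> simp [hx]
  rw [mgf, h1, integral_add (integrable_const _)
    ((integrable_const _).indicator hB), integral_indicator_const _ hB]
  simp only [integral_const, probReal_univ, smul_eq_mul, mul_one]
  have h2 := Real.add_one_le_exp (ν.real B * (s + s ^ 2))
  have h3 := mul_le_mul_of_nonneg_left (exp_le_one_add_add_sq hs)
    (measureReal_nonneg (μ := ν) (s := B))
  nlinarith

theorem integrable_exp_mul_indicator {ν : Measure ℝ} [IsProbabilityMeasure ν] {B : Set ℝ}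
    (hB : MeasurableSet B) (s : ℝ) :
    Integrable (fun x => Real.exp (s * B.indicator (fun _ => (1 : ℝ)) x)) ν := by
  have h1 : (fun x => Real.exp (s * B.indicator (fun _ => (1 : ℝ)) x))
      = fun x => 1 + B.indicator (fun _ => Real.exp s - 1) x := by
    funext x
    by_cases hx : x ∈ B <;> simp [hx]
  rw [h1]
  exact (integrable_const _).add ((integrable_const _).indicator hB)

/-! ### Exponential weights and their partial sums -/

instance isProbabilityMeasure_expMeasure_one : IsProbabilityMeasure (expMeasure 1) :=
  isProbabilityMeasure_expMeasure one_pos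

theorem expMeasure_one_eq_withDensity :
    expMeasure 1 = (volume.restrict (Ici 0)).withDensity
      fun x => ENNReal.ofReal (Real.exp (-x)) := by
  rw [← withDensity_indicator measurableSet_Ici]
  change volume.withDensity (exponentialPDF 1) = _
  congr 1
  funext x
  rw [exponentialPDF_eq]
  by_cases hx : 0 ≤ x <;> simp [hx]

theorem integral_exp_mul_expMeasure_one {s : ℝ} (hs : s < 1) :
    Integrable (fun x => Real.exp (s * x)) (expMeasure 1) ∧
      ∫ x, Real.exp (s * x) ∂(expMeasure 1) = (1 - s)⁻¹ := by
  have h (x : ℝ) : (ENNReal.ofReal (Real.exp (-x))).toReal • Real.exp (s * x)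
      = Real.exp ((s - 1) * x) := by
    rw [ENNReal.toReal_ofReal (Real.exp_pos _).le, smul_eq_mul, ← Real.exp_add]
    congr 1; ring
  constructor
  · rw [expMeasure_one_eq_withDensity, integrable_withDensity_iff_integrable_smul' (by fun_prop)
      (by simp)]
    simp_rw [h]
    exact (integrableOn_exp_mul_Ioi (by linarith) 0).congr_set_ae Ioi_ae_eq_Ici.symm
  · rw [expMeasure_one_eq_withDensity, integral_withDensity_eq_integral_toReal_smul (by fun_prop)
      (by simp)]
    simp_rw [h]
    rw [integral_Ici_eq_integral_Ioi, integral_exp_mul_Ioi (by linarith)]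
    simp only [mul_zero, Real.exp_zero]
    rw [← neg_sub s 1, inv_eq_one_div, div_neg, neg_div]

theorem expMeasure_one_real_Iio_le {x : ℝ} (hx : 0 ≤ x) : (expMeasure 1).real (Iio x) ≤ x := by
  have h := cdf_expMeasure_eq (r := 1) one_pos x
  rw [cdf_eq_real, if_pos hx] at h
  have h2 : (expMeasure 1).real (Iio x) ≤ (expMeasure 1).real (Iic x) :=
    measureReal_mono Iio_subset_Iic_self
  have := Real.add_one_le_exp (-(1 * x))
  linarith

theorem expMeasure_one_real_Ioi {x : ℝ} (hx : 0 ≤ x) :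
    (expMeasure 1).real (Ioi x) = Real.exp (-x) := by
  have h := cdf_expMeasure_eq (r := 1) one_pos x
  rw [cdf_eq_real, if_pos hx] at h
  rw [← compl_Iic, probReal_compl_eq_one_sub measurableSet_Iic, h]
  simp

/-- Concentration of `W_k` around `k`. -/
theorem measureReal_abs_partialSum_sub_ge_le {N k : ℕ} (hk : k ≤ N + 1) {ε : ℝ} (hε : 0 ≤ ε)
    (hε1 : ε ≤ 1) :
    (Measure.pi fun _ : Fin (N + 1) => expMeasure 1).real {w | ε * k ≤ |partialSum w k - k|}
      ≤ 2 * Real.exp (-(ε ^ 2 * k / 4)) := by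
  have hc : ∑ i : Fin (N + 1), (if (i : ℕ) < k then (1 : ℝ) else 0) = k := by
    rw [Fin.sum_univ_eq_sum_range (fun i => if i < k then (1 : ℝ) else 0), Finset.sum_boole]
    congr 1
    rw [Finset.range_eq_Ico, Finset.Ico_filter_lt, Nat.card_Ico]
    omega
  have := pi_measureReal_abs_sum_sub_ge_le (fun _ : Fin (N + 1) => expMeasure 1)
    (fun i x => if (i : ℕ) < k then x else 0) (fun i => if (i : ℕ) < k then 1 else 0)
    (fun i s hs => ?_) (fun i s hs => ?_) hε hε1
  · rw [hc] at this
    exact this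
  · split_ifs
    · exact (integral_exp_mul_expMeasure_one (by linarith [le_abs_self s])).1
    · simp
  · split_ifs
    · rw [mgf, (integral_exp_mul_expMeasure_one (by linarith [le_abs_self s])).2, one_mul]
      exact inv_one_sub_le_exp hs
    · simp [mgf]

/-! ### The law of a left endpoint -/

theorem leftLaw_Ioc {r u v : ℝ} (hr : 0 < r) (hu : 0 ≤ u) (huv : u ≤ v) (hvr : v ≤ r) :
    (leftLaw r).real (Ioc u v) = (√v - √u) / √r := by
  have hint : IntervalIntegrable (fun x : ℝ => x ^ (-(1 / 2) : ℝ)) volume u v :=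
    intervalIntegral.intervalIntegrable_rpow' (by norm_num)
  have h1 : ∀ x ∈ Ioc u v, leftDensity r x
      = ENNReal.ofReal ((1 / (2 * √r)) * x ^ (-(1 / 2) : ℝ)) := by
    intro x hx
    have hx0 : 0 < x := hu.trans_lt hx.1
    rw [leftDensity, if_pos ⟨hx0, hx.2.trans hvr⟩, Real.sqrt_mul hr.le,
      Real.rpow_neg hx0.le, ← Real.sqrt_eq_rpow]
    congr 1
    field_simp
  have h0 : √r ≠ 0 := (Real.sqrt_pos.2 hr).ne'
  rw [measureReal_def, leftLaw, withDensity_apply _ measurableSet_Ioc,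
    setLIntegral_congr_fun measurableSet_Ioc h1, ← ofReal_integral_eq_lintegral_ofReal]
  · rw [← intervalIntegral.integral_of_le huv, intervalIntegral.integral_const_mul,
      integral_rpow (Or.inl (by norm_num))]
    have : (-(1 / 2) + 1 : ℝ) = 1 / 2 := by norm_num
    rw [this, ← Real.sqrt_eq_rpow, ← Real.sqrt_eq_rpow, ENNReal.toReal_ofReal]
    · field_simp
    · have := Real.sqrt_le_sqrt huv
      have : 0 ≤ √v - √u := by linarith
      positivity
  · exact ((intervalIntegrable_iff_integrableOn_Ioc_of_le huv).1 hint).const_mul _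
  · filter_upwards [ae_restrict_mem measurableSet_Ioc] with x hx
    have := hu.trans_lt hx.1
    positivity

theorem leftLaw_Ioc_of_le {r u v : ℝ} (hru : r ≤ u) : (leftLaw r).real (Ioc u v) = 0 := by
  have h1 : ∀ x ∈ Ioc u v, leftDensity r x = 0 := fun x hx => by
    rw [leftDensity, if_neg]
    exact fun h => absurd (hx.1.trans_le h.2) (not_lt.2 hru)
  rw [measureReal_def, leftLaw, withDensity_apply _ measurableSet_Ioc,
    setLIntegral_congr_fun measurableSet_Ioc h1]
  simp

/-! ### Consequences of positive weights -/

section PositiveWeights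

variable {N : ℕ} {w : Fin (N + 1) → ℝ}

theorem partialSum_zero : partialSum w 0 = 0 := by simp [partialSum]

theorem partialSum_mono (hw : ∀ i, 0 < w i) : Monotone (partialSum w) := fun a b hab => by
  refine Finset.sum_le_sum fun i _ => ?_
  split_ifs with h1 h2
  exacts [le_rfl, absurd (h1.trans_le hab) h2, (hw i).le, le_rfl]

theorem partialSum_nonneg (hw : ∀ i, 0 < w i) (j : ℕ) : 0 ≤ partialSum w j :=
  partialSum_zero (w := w) ▸ partialSum_mono hw (Nat.zero_le j)

theorem partialSum_add_le (hw : ∀ i, 0 < w i) {a b : ℕ} {i : Fin (N + 1)} (hai : a ≤ i)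
    (hib : (i : ℕ) < b) : partialSum w a + w i ≤ partialSum w b := by
  have h : w i = ∑ l : Fin (N + 1), if l = i then w l else 0 := by simp
  rw [h, partialSum, partialSum, ← Finset.sum_add_distrib]
  refine Finset.sum_le_sum fun l _ => ?_
  have := hw l
  by_cases hl : l = i
  · subst hl
    rw [if_neg (not_lt.2 hai), if_pos rfl, if_pos hib, zero_add]
  · rw [if_neg hl, add_zero]
    split_ifs with h1 h2
    · exact le_rfl
    · omega
    · exact this.le
    · exact le_rfl

theorem partialSum_lt (hw : ∀ i, 0 < w i) {a b : ℕ} (hab : a < b) (ha : a < N + 1) :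
    partialSum w a < partialSum w b := by
  have := partialSum_add_le hw (i := ⟨a, ha⟩) le_rfl hab
  linarith [hw ⟨a, ha⟩]

theorem partialSum_pos (hw : ∀ i, 0 < w i) {a : ℕ} (ha : 0 < a) : 0 < partialSum w a :=
  partialSum_zero (w := w) ▸ partialSum_lt hw ha N.succ_pos

theorem partialSum_le_mul {q : ℝ} (hq : 0 ≤ q) (hw : ∀ i, w i ≤ q) (j : ℕ) :
    partialSum w j ≤ j * q := by
  calc partialSum w j ≤ ∑ i : Fin (N + 1), if (i : ℕ) < j then q else 0 := by
        refine Finset.sum_le_sum fun i _ => ?_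
        split_ifs
        exacts [hw i, le_rfl]
    _ = ((Finset.univ.filter fun i : Fin (N + 1) => (i : ℕ) < j).card : ℝ) * q := by
        rw [← Finset.sum_filter, Finset.sum_const, nsmul_eq_mul]
    _ ≤ j * q := by
        gcongr
        have : (Finset.univ.filter fun i : Fin (N + 1) => (i : ℕ) < j).card
            ≤ (Finset.range j).card :=
          Finset.card_le_card_of_injOn (fun i => (i : ℕ)) (by intro i; simp)
            fun a _ b _ h => Fin.ext h
        simpa using this

theorem rightEnd_mono (hw : ∀ i, 0 < w i) : Monotone (rightEnd w) := fun _ _ hab =>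
  div_le_div_of_nonneg_right (partialSum_mono hw hab) (partialSum_nonneg hw _)

theorem rightEnd_lt (hw : ∀ i, 0 < w i) {a b : ℕ} (hab : a < b) (ha : a < N + 1) :
    rightEnd w a < rightEnd w b :=
  div_lt_div_of_pos_right (partialSum_lt hw hab ha) (partialSum_pos hw N.succ_pos)

theorem rightEnd_nonneg (hw : ∀ i, 0 < w i) (a : ℕ) : 0 ≤ rightEnd w a :=
  div_nonneg (partialSum_nonneg hw _) (partialSum_nonneg hw _)

theorem rightEnd_pos (hw : ∀ i, 0 < w i) {a : ℕ} (ha : 0 < a) : 0 < rightEnd w a :=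
  div_pos (partialSum_pos hw ha) (partialSum_pos hw N.succ_pos)

/-- Consecutive half-open intervals between the `R_i` glue together. The index satisfies `i ≥ 1`, so
the truncated `i - 1` is the true predecessor. -/
theorem blockVertex_eq_Ioc (hw : ∀ i, 0 < w i) (m j : ℕ) :
    blockVertex m w j = Ioc (rightEnd w (m * (j - 1))) (rightEnd w (m * j)) := by
  rw [← (rightEnd_mono hw).biUnion_Ico_Ioc_map_succ (m * (j - 1)) (m * j)]
  ext x
  simp only [blockVertex, chordVertex, mem_iUnion, Finset.mem_Icc, mem_Ico, Nat.succ_eq_succ,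
    exists_prop]
  constructor
  · rintro ⟨i, hi, hx⟩
    exact ⟨i - 1, by omega, by rwa [Nat.succ_eq_add_one, Nat.sub_add_cancel (by omega)]⟩
  · rintro ⟨i, hi, hx⟩
    exact ⟨i + 1, by omega, by simpa using hx⟩

theorem measurableSet_blockVertex (m : ℕ) (w : Fin (N + 1) → ℝ) (j : ℕ) :
    MeasurableSet (blockVertex m w j) :=
  Finset.measurableSet_biUnion _ fun _ _ => measurableSet_Ioc

theorem isProbabilityMeasure_leftLaw_rightEnd (hw : ∀ i, 0 < w i) (k : ℕ) :
    IsProbabilityMeasure (leftLaw (rightEnd w (k + 1))) :=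
  isProbabilityMeasure_leftLaw (rightEnd_pos hw k.succ_pos)

theorem card_filter_lt_le (N a b : ℕ) :
    (Finset.univ.filter fun k : Fin N => a < (k : ℕ) + 1 ∧ (k : ℕ) + 1 ≤ b).card ≤ b - a := by
  have : (Finset.univ.filter fun k : Fin N => a < (k : ℕ) + 1 ∧ (k : ℕ) + 1 ≤ b).card
      ≤ (Finset.Ico a b).card :=
    Finset.card_le_card_of_injOn (fun i => (i : ℕ)) (fun i hi => Finset.mem_coe.2
      (Finset.mem_Ico.2 ((Finset.mem_filter.1 hi).2.imp_left Nat.le_of_lt_succ)))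
      fun a _ b _ h => Fin.ext h
  simpa using this

/-- At most `m` right endpoints belong to a given vertex. -/
theorem sum_indicator_rightEnd_le (hw : ∀ i, 0 < w i) (m : ℕ) {j : ℕ} (hj : 1 ≤ j)
    (hjN : m * j ≤ N) :
    ∑ k : Fin N, (blockVertex m w j).indicator (fun _ => (1 : ℕ)) (rightEnd w (k + 1)) ≤ m := by
  have hle : m * (j - 1) ≤ m * j := Nat.mul_le_mul_left _ (Nat.sub_le _ _)
  have hm : m * j - m * (j - 1) = m := by
    obtain ⟨i, rfl⟩ := Nat.exists_eq_add_of_le' hj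
    simp [Nat.mul_succ]
  calc ∑ k : Fin N, (blockVertex m w j).indicator (fun _ => (1 : ℕ)) (rightEnd w (k + 1))
      ≤ ∑ k : Fin N, if m * (j - 1) < (k : ℕ) + 1 ∧ (k : ℕ) + 1 ≤ m * j then 1 else 0 := by
        refine Finset.sum_le_sum fun k _ => ?_
        rw [blockVertex_eq_Ioc hw m j]
        by_cases hx : rightEnd w (k + 1) ∈ Ioc (rightEnd w (m * (j - 1))) (rightEnd w (m * j))
        · have h1 : m * (j - 1) < (k : ℕ) + 1 :=
            lt_of_not_ge fun h => absurd hx.1 (not_lt.2 (rightEnd_mono hw h))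
          have h2 : (k : ℕ) + 1 ≤ m * j := le_of_not_gt fun h =>
            absurd hx.2 (not_le.2 (rightEnd_lt hw h (Nat.lt_succ_of_le hjN)))
          rw [indicator_of_mem hx, if_pos ⟨h1, h2⟩]
        · rw [indicator_of_notMem hx]
          exact Nat.zero_le _
    _ ≤ m := by
        rw [Finset.sum_boole]
        exact (card_filter_lt_le N _ _).trans_eq hm

/-- Up to an error `m`, the conditional expectation of the number of left endpoints in vertex `j`
is `(√W_{mj} - √W_{m(j-1)}) ∑_{k = mj}^N 1 / √W_k`. -/
theorem abs_sum_leftLaw_blockVertex_sub_le (hw : ∀ i, 0 < w i) {m : ℕ} (hm : 1 ≤ m) {j : ℕ}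
    (hj : 1 ≤ j) (hjN : m * j ≤ N) :
    |∑ k : Fin N, (leftLaw (rightEnd w (k + 1))).real (blockVertex m w j)
      - (√(partialSum w (m * j)) - √(partialSum w (m * (j - 1))))
        * (∑ k ∈ Finset.range N, 1 / √(partialSum w (k + 1))
          - ∑ k ∈ Finset.range (m * j - 1), 1 / √(partialSum w (k + 1)))| ≤ m := by
  have hle : m * (j - 1) ≤ m * j := Nat.mul_le_mul_left _ (Nat.sub_le _ _)
  have hmj : 1 ≤ m * j := Nat.mul_pos hm hj
  have hmsub : m * j - m * (j - 1) = m := by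
    obtain ⟨i, rfl⟩ := Nat.exists_eq_add_of_le' hj
    simp [Nat.mul_succ]
  set d := √(partialSum w (m * j)) - √(partialSum w (m * (j - 1))) with hd
  -- Index `k` stands for `W_{k+1}`, so removing `range (m * j - 1)` leaves exactly the terms `W_k`
  -- with `k ≥ mj`.
  have hS : ∑ k ∈ Finset.range N, 1 / √(partialSum w (k + 1))
      - ∑ k ∈ Finset.range (m * j - 1), 1 / √(partialSum w (k + 1))
      = ∑ k : Fin N, if m * j ≤ (k : ℕ) + 1 then 1 / √(partialSum w (k + 1)) else 0 := by
    rw [← Finset.sum_Ico_eq_sub _ (by omega),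
      Fin.sum_univ_eq_sum_range
        (fun k => if m * j ≤ k + 1 then 1 / √(partialSum w (k + 1)) else 0),
      ← Finset.sum_filter]
    refine Finset.sum_congr ?_ fun _ _ => rfl
    ext k
    simp only [Finset.mem_Ico, Finset.mem_filter, Finset.mem_range]
    omega
  rw [hS, Finset.mul_sum, ← Finset.sum_sub_distrib]
  -- The formula is exact for right endpoints at or beyond `R_{mj}`, and both sides vanish for those
  -- at or before `R_{m(j-1)}`. Only the at most `m` chords ending inside the block can contribute
  -- an error, each at most `1`.
  calc _ ≤ ∑ k : Fin N, |(leftLaw (rightEnd w (k + 1))).real (blockVertex m w j)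
          - d * (if m * j ≤ (k : ℕ) + 1 then 1 / √(partialSum w (k + 1)) else 0)| :=
        Finset.abs_sum_le_sum_abs _ _
    _ ≤ ∑ k : Fin N, if m * (j - 1) < (k : ℕ) + 1 ∧ (k : ℕ) + 1 ≤ m * j then (1 : ℝ) else 0 := by
        refine Finset.sum_le_sum fun k _ => ?_
        have := isProbabilityMeasure_leftLaw_rightEnd hw k
        have hW : 0 < partialSum w (N + 1) := partialSum_pos hw N.succ_pos
        rcases le_or_gt (m * j) (k + 1) with h | h
        · have e : (leftLaw (rightEnd w (k + 1))).real (blockVertex m w j)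
              = d * (1 / √(partialSum w (k + 1))) := by
            rw [blockVertex_eq_Ioc hw m j, leftLaw_Ioc (rightEnd_pos hw k.1.succ_pos)
              (rightEnd_nonneg hw _) (rightEnd_mono hw hle) (rightEnd_mono hw h)]
            simp only [rightEnd, Real.sqrt_div (partialSum_nonneg hw _)]
            have h1 : √(partialSum w (N + 1)) ≠ 0 := (Real.sqrt_pos.2 hW).ne'
            have h2 : √(partialSum w (k + 1)) ≠ 0 :=
              (Real.sqrt_pos.2 (partialSum_pos hw k.1.succ_pos)).ne'
            rw [hd]
            field_simp
          rw [if_pos h, e, sub_self, abs_zero]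
          split_ifs <;> norm_num
        · rw [if_neg (not_le.2 h), mul_zero, sub_zero, abs_of_nonneg measureReal_nonneg]
          rcases le_or_gt ((k : ℕ) + 1) (m * (j - 1)) with h' | h'
          · rw [blockVertex_eq_Ioc hw m j, leftLaw_Ioc_of_le (rightEnd_mono hw h')]
            split_ifs <;> norm_num
          · rw [if_pos ⟨h', h.le⟩]
            exact measureReal_le_one
    _ ≤ m := by
        rw [Finset.sum_boole]
        exact_mod_cast (card_filter_lt_le N _ _).trans_eq hmsub

end PositiveWeights

/-! ### Sums of inverse square roots -/

/-- Writing `|√W - √k| = |W - k| / (√W + √k)` gains a factor `√k`, and `√W ≥ √k / 2` bounds the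
remaining denominator. An error of order `1 / k` sums to a mere logarithm. -/
theorem abs_one_div_sqrt_sub_le {W k c : ℝ} (hk : 0 < k) (hW : k / 4 ≤ W)
    (h : |W - k| ≤ c * √k) : |1 / √W - 1 / √k| ≤ 2 * c / k := by
  have hW0 : 0 < W := by linarith
  obtain ⟨a, ha, ha2⟩ : ∃ a, 0 < a ∧ W = a ^ 2 :=
    ⟨√W, Real.sqrt_pos.2 hW0, (Real.sq_sqrt hW0.le).symm⟩
  obtain ⟨b, hb, hb2⟩ : ∃ b, 0 < b ∧ k = b ^ 2 :=
    ⟨√k, Real.sqrt_pos.2 hk, (Real.sq_sqrt hk.le).symm⟩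
  subst ha2 hb2
  rw [Real.sqrt_sq ha.le, Real.sqrt_sq hb.le] at *
  have hab : b / 2 ≤ a := by
    by_contra! hlt
    nlinarith
  have h1 : |a - b| * (a + b) ≤ c * b := by
    rw [← abs_of_pos (show 0 < a + b by linarith), ← abs_mul]
    rw [show (a - b) * (a + b) = a ^ 2 - b ^ 2 by ring]
    exact h
  have hc : 0 ≤ c := by
    have h0 : 0 ≤ c * b := le_trans (by positivity) h1
    exact nonneg_of_mul_nonneg_left h0 hb
  have h2 : |1 / a - 1 / b| = |a - b| / (a * b) := by
    rw [div_sub_div _ _ ha.ne' hb.ne', abs_div, abs_of_pos (mul_pos ha hb), abs_sub_comm]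
    ring_nf
  rw [h2, div_le_div_iff₀ (by positivity) (by positivity)]
  have h3 : |a - b| * b ≤ 2 * c * a := by
    nlinarith [abs_nonneg (a - b), mul_nonneg (abs_nonneg (a - b)) ha.le,
      mul_le_mul_of_nonneg_left hab hc]
  nlinarith

theorem abs_sum_one_div_sqrt_sub_le (u : ℕ) :
    |∑ k ∈ Finset.range u, 1 / √((k : ℝ) + 1) - 2 * √u| ≤ 2 := by
  -- Each term lies between two increments of `2 √·`, so both bounds telescope.
  have h (k : ℕ) : 2 * (√((k : ℝ) + 1 + 1) - √((k : ℝ) + 1)) ≤ 1 / √((k : ℝ) + 1) ∧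
      1 / √((k : ℝ) + 1) ≤ 2 * (√((k : ℝ) + 1) - √k) := by
    have h0 : (0 : ℝ) ≤ k := k.cast_nonneg
    have p1 : 0 < √((k : ℝ) + 1) := Real.sqrt_pos.2 (by linarith)
    have s0 := Real.sq_sqrt h0
    have s1 := Real.sq_sqrt (show (0 : ℝ) ≤ k + 1 by linarith)
    have s2 := Real.sq_sqrt (show (0 : ℝ) ≤ k + 1 + 1 by linarith)
    constructor
    · rw [le_div_iff₀ p1]
      nlinarith [sq_nonneg (√((k : ℝ) + 1 + 1) - √((k : ℝ) + 1))]
    · rw [div_le_iff₀ p1]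
      nlinarith [sq_nonneg (√((k : ℝ) + 1) - √k)]
  have h1 (u : ℕ) : 2 * √((u : ℝ) + 1) - 2 ≤ ∑ k ∈ Finset.range u, 1 / √((k : ℝ) + 1) ∧
      ∑ k ∈ Finset.range u, 1 / √((k : ℝ) + 1) ≤ 2 * √u := by
    induction u with
    | zero => simp
    | succ u ih =>
      rw [Finset.sum_range_succ]
      push_cast
      obtain ⟨ha, hb⟩ := h u
      constructor <;> linarith [ih.1, ih.2]
  have h2 : √(u : ℝ) ≤ √((u : ℝ) + 1) := Real.sqrt_le_sqrt (by linarith)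
  rw [abs_le]
  constructor <;> linarith [(h1 u).1, (h1 u).2]

/-- If `W_k` is close to `k` for large `k` and `W_1` is not too small, then
`∑_{k ≤ u} 1 / √W_k` is close to `2 √u`. -/
theorem abs_sum_one_div_sqrt_partialSum_sub_le {N : ℕ} {w : Fin (N + 1) → ℝ} (hw : ∀ i, 0 < w i)
    {q y : ℝ} (hq : 1 ≤ q) (hy : 0 < y) (hyw : y ≤ w 0)
    (hconc : ∀ k ∈ Finset.Icc 1 N, 4 * q ≤ k → |partialSum w k - k| < √(q / k) * k)
    {u : ℕ} (hu : u ≤ N) :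
    |∑ k ∈ Finset.range u, 1 / √(partialSum w (k + 1)) - 2 * √u|
      ≤ (4 * q + 1) * (1 / √y + 1) + 2 * q * (1 + Real.log N) + 2 := by
  have hterm : ∀ k ∈ Finset.range u, |1 / √(partialSum w (k + 1)) - 1 / √((k : ℝ) + 1)|
      ≤ (if ((k : ℝ) + 1) < 4 * q then 1 / √y + 1 else 0) + 2 * q * ((k : ℝ) + 1)⁻¹ := by
    intro k hk
    have hkN : k < N := (Finset.mem_range.1 hk).trans_le hu
    have hk0 : (0 : ℝ) < (k : ℝ) + 1 := by positivity
    split_ifs with h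
    -- For small indices there is no concentration; `W_{k+1} ≥ w_1 ≥ y` bounds each of the at most
    -- `4q + 1` terms.
    · have hyW : y ≤ partialSum w (k + 1) := by
        have := partialSum_add_le hw (i := 0) (a := 0) (b := k + 1) le_rfl k.succ_pos
        rw [partialSum_zero] at this
        linarith
      have h1 : 1 / √(partialSum w (k + 1)) ≤ 1 / √y :=
        one_div_le_one_div_of_le (Real.sqrt_pos.2 hy) (Real.sqrt_le_sqrt hyW)
      have h2 : 1 / √((k : ℝ) + 1) ≤ 1 := by
        rw [div_le_one (Real.sqrt_pos.2 hk0)]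
        exact Real.one_le_sqrt.2 (by linarith [k.cast_nonneg (α := ℝ)])
      have h3 : 0 ≤ 1 / √(partialSum w (k + 1)) := by positivity
      have h4 : 0 ≤ 1 / √((k : ℝ) + 1) := by positivity
      have h5 : 0 ≤ 2 * q * ((k : ℝ) + 1)⁻¹ := by positivity
      rw [abs_le]
      constructor <;> linarith
    · push Not at h
      have hc := hconc (k + 1) (Finset.mem_Icc.2 ⟨by omega, by omega⟩) (by push_cast; exact h)
      push_cast at hc
      have e : √(q / ((k : ℝ) + 1)) * ((k : ℝ) + 1) = √q * √((k : ℝ) + 1) := by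
        rw [Real.sqrt_div (by linarith)]
        have := Real.mul_self_sqrt hk0.le
        have h0 : √((k : ℝ) + 1) ≠ 0 := (Real.sqrt_pos.2 hk0).ne'
        field_simp
        nlinarith
      -- The threshold `4q` makes the relative deviation at most `1 / 2`, so that `W` stays
      -- comparable to its index.
      have h6 : √(q / ((k : ℝ) + 1)) ≤ 1 / 2 := by
        rw [Real.sqrt_le_left (by norm_num), div_le_iff₀ hk0]
        linarith
      have h7 : ((k : ℝ) + 1) / 4 ≤ partialSum w (k + 1) := by
        have := (abs_lt.1 hc).1
        nlinarith
      have h8 := abs_one_div_sqrt_sub_le hk0 h7 (c := √q) (by rw [← e]; exact hc.le)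
      have h9 : √q ≤ q := Real.sqrt_le_left (by linarith) |>.2 (by nlinarith)
      rw [zero_add]
      refine h8.trans ?_
      rw [div_eq_mul_inv]
      gcongr
  have hsum : |∑ k ∈ Finset.range u, 1 / √(partialSum w (k + 1))
      - ∑ k ∈ Finset.range u, 1 / √((k : ℝ) + 1)|
      ≤ (4 * q + 1) * (1 / √y + 1) + 2 * q * (1 + Real.log N) := by
    rw [← Finset.sum_sub_distrib]
    refine (Finset.abs_sum_le_sum_abs _ _).trans ((Finset.sum_le_sum hterm).trans ?_)
    rw [Finset.sum_add_distrib, ← Finset.mul_sum, ← Finset.sum_filter, Finset.sum_const,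
      nsmul_eq_mul]
    have hcard : ((Finset.filter (fun k : ℕ => (k : ℝ) + 1 < 4 * q) (Finset.range u)).card : ℝ)
        ≤ 4 * q + 1 := by
      have h1 : Finset.filter (fun k : ℕ => (k : ℝ) + 1 < 4 * q) (Finset.range u)
          ⊆ Finset.range ⌈4 * q⌉₊ := by
        intro k hk
        rw [Finset.mem_filter] at hk
        exact Finset.mem_range.2 (Nat.lt_ceil.2 (by linarith [hk.2]))
      have h2 := Finset.card_le_card h1
      rw [Finset.card_range] at h2
      exact (Nat.cast_le.2 h2).trans (Nat.ceil_lt_add_one (by linarith)).le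
    have hharm : ∑ k ∈ Finset.range u, ((k : ℝ) + 1)⁻¹ ≤ 1 + Real.log N := by
      have h1 := harmonic_le_one_add_log N
      rw [harmonic] at h1
      push_cast at h1
      refine le_trans (Finset.sum_le_sum_of_subset_of_nonneg (Finset.range_mono hu)
        fun k _ _ => by positivity) h1
    gcongr
  have h2 := abs_sum_one_div_sqrt_sub_le u
  calc _ = |(∑ k ∈ Finset.range u, 1 / √(partialSum w (k + 1))
      - ∑ k ∈ Finset.range u, 1 / √((k : ℝ) + 1))
      + (∑ k ∈ Finset.range u, 1 / √((k : ℝ) + 1) - 2 * √u)| := by ring_nf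
    _ ≤ _ := (abs_add_le _ _).trans (add_le_add hsum h2)

/-! ### Lower bound for `𝒟(j)` and conditional concentration of `D(j)` -/

/-- A lower bound for `𝒟(j)`. -/
theorem le_approxDegree {m n : ℕ} (hm : 1 ≤ m) {w : Fin (m * n + 1) → ℝ} (hw : ∀ i, 0 < w i)
    {q x A : ℝ} (hx : 0 ≤ x) (hwq : ∀ i, w i ≤ q) {j : ℕ} (hj : 1 ≤ j) (hjA : j ≤ A)
    (hblock : ∃ i : Fin (m * n + 1), m * (j - 1) ≤ i ∧ (i : ℕ) < m * j ∧ x ≤ w i) :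
    √(n / (A * q)) * x ≤ approxDegree m n w j := by
  obtain ⟨i, hi1, hi2, hxi⟩ := hblock
  have hq : 0 < q := (hw 0).trans_le (hwq 0)
  have hm0 : (0 : ℝ) < m := by exact_mod_cast hm
  have hA : 0 < A := lt_of_lt_of_le (by exact_mod_cast hj) hjA
  have hab := partialSum_add_le hw hi1 hi2
  have hb := partialSum_le_mul hq.le hwq (m * j)
  have ha0 := partialSum_nonneg hw (m * (j - 1))
  have hb0 : 0 < partialSum w (m * j) := partialSum_pos hw (Nat.mul_pos hm hj)
  rw [approxDegree]
  set a := partialSum w (m * (j - 1))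
  set b := partialSum w (m * j)
  have hb' : b ≤ m * (A * q) := by
    refine hb.trans ?_
    push_cast
    rw [mul_assoc]
    gcongr
  have hsb : √b ≤ √m * √(A * q) := by
    rw [← Real.sqrt_mul hm0.le]
    exact Real.sqrt_le_sqrt hb'
  have hsa : √a ≤ √b := Real.sqrt_le_sqrt (by linarith [hw i])
  -- This is `x ≤ b - a = (√b - √a)(√b + √a)` together with `√a ≤ √b`.
  have hd : x ≤ 2 * √b * (√b - √a) := by
    have h1 := Real.sq_sqrt ha0
    have h2 := Real.sq_sqrt hb0.le
    nlinarith [Real.sqrt_nonneg a, Real.sqrt_nonneg b,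
      mul_nonneg (sub_nonneg.2 hsa) (sub_nonneg.2 hsa)]
  rw [Real.sqrt_div n.cast_nonneg, Real.sqrt_mul hm0.le, div_mul_eq_mul_div,
    div_le_iff₀ (Real.sqrt_pos.2 (by positivity))]
  calc √(n : ℝ) * x ≤ √(n : ℝ) * (2 * √b * (√b - √a)) := by gcongr
    _ ≤ √(n : ℝ) * (2 * (√m * √(A * q)) * (√b - √a)) := by
        have : 0 ≤ √b - √a := sub_nonneg.2 hsa
        gcongr
    _ = _ := by ring

/-- The conditional mean of the number of left endpoints in vertex `j` is close to `𝒟(j)`. -/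
theorem abs_sum_leftLaw_blockVertex_sub_approxDegree_le {m n : ℕ} (hm : 1 ≤ m)
    {w : Fin (m * n + 1) → ℝ} (hw : ∀ i, 0 < w i) {j : ℕ} (hj : 1 ≤ j) (hjn : j ≤ n) {E θ : ℝ}
    (hE : ∀ u ≤ m * n, |∑ k ∈ Finset.range u, 1 / √(partialSum w (k + 1)) - 2 * √u| ≤ E)
    (hEθ : 2 * E + 2 * √((m : ℝ) * j) ≤ 3 * θ * √((m : ℝ) * n))
    (hmθ : m ≤ θ * approxDegree m n w j) :
    |∑ k : Fin (m * n), (leftLaw (rightEnd w (k + 1))).real (blockVertex m w j)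
      - approxDegree m n w j| ≤ 5 / 2 * θ * approxDegree m n w j := by
  have hle : m * (j - 1) ≤ m * j := Nat.mul_le_mul_left _ (Nat.sub_le _ _)
  have hjN : m * j ≤ m * n := Nat.mul_le_mul_left _ hjn
  have h1 := abs_sum_leftLaw_blockVertex_sub_le hw hm hj hjN
  have h2 := hE (m * n) le_rfl
  have h3 := hE (m * j - 1) (by omega)
  have h4 : √((m * j - 1 : ℕ) : ℝ) ≤ √((m : ℝ) * j) := by
    refine Real.sqrt_le_sqrt ?_
    rw [← Nat.cast_mul]
    exact Nat.cast_le.2 (Nat.sub_le _ _)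
  have h5 : 0 ≤ √((m * j - 1 : ℕ) : ℝ) := Real.sqrt_nonneg _
  have hd0 : 0 ≤ √(partialSum w (m * j)) - √(partialSum w (m * (j - 1))) :=
    sub_nonneg.2 (Real.sqrt_le_sqrt (partialSum_mono hw hle))
  rw [approxDegree] at *
  push_cast at h2
  set d := √(partialSum w (m * j)) - √(partialSum w (m * (j - 1)))
  set S := ∑ k ∈ Finset.range (m * n), 1 / √(partialSum w (k + 1))
  set S' := ∑ k ∈ Finset.range (m * j - 1), 1 / √(partialSum w (k + 1))
  set M := ∑ k : Fin (m * n), (leftLaw (rightEnd w (k + 1))).real (blockVertex m w j)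
  set r := √((m : ℝ) * n)
  have h6 : |S - S' - 2 * r| ≤ 3 * θ * r := by
    rw [abs_le] at *
    constructor <;> linarith
  have h7 : |d * (S - S') - 2 * r * d| ≤ d * (3 * θ * r) := by
    rw [show d * (S - S') - 2 * r * d = d * (S - S' - 2 * r) by ring, abs_mul, abs_of_nonneg hd0]
    exact mul_le_mul_of_nonneg_left h6 hd0
  -- The factor `5 / 2` is `3 / 2` from replacing `S - S'` by `2 r`, plus `1` from the error `m ≤ θ
  -- 𝒟(j)`.
  rw [abs_le] at *
  constructor <;> nlinarith

theorem degree_cast_mem {m : ℕ} {N : ℕ} {w : Fin (N + 1) → ℝ} (hw : ∀ i, 0 < w i) {j : ℕ}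
    (hj : 1 ≤ j) (hjN : m * j ≤ N) (l : Fin N → ℝ) :
    ∑ k : Fin N, (blockVertex m w j).indicator (fun _ => (1 : ℝ)) (l k)
        ≤ (degree m (w, l) j : ℝ) ∧
      (degree m (w, l) j : ℝ)
        ≤ ∑ k : Fin N, (blockVertex m w j).indicator (fun _ => (1 : ℝ)) (l k) + m := by
  have h := sum_indicator_rightEnd_le hw m hj hjN
  have e : ∑ k : Fin N, (blockVertex m w j).indicator (fun _ => (1 : ℝ)) (l k)
      = ((∑ k : Fin N, (blockVertex m w j).indicator (fun _ => (1 : ℕ)) (l k) : ℕ) : ℝ) := by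
    push_cast
    refine Finset.sum_congr rfl fun k _ => ?_
    by_cases hx : l k ∈ blockVertex m w j <;> simp [hx]
  rw [e, degree, Finset.sum_add_distrib]
  constructor
  · exact_mod_cast Nat.le_add_right _ _
  · exact_mod_cast Nat.add_le_add_left h _

/-- Conditionally on the weights, the degree of vertex `j` is concentrated. -/
theorem leftKernel_abs_degree_sub_gt_le {m : ℕ} {N : ℕ} {w : Fin (N + 1) → ℝ}
    (hw : ∀ i, 0 < w i) {j : ℕ} (hj : 1 ≤ j) (hjN : m * j ≤ N) {θ D : ℝ} (hθ : 0 ≤ θ)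
    (hθ1 : θ ≤ 1 / 5) (hmD : m ≤ θ * D)
    (hmean : |∑ k : Fin N, (leftLaw (rightEnd w (k + 1))).real (blockVertex m w j) - D|
      ≤ 5 / 2 * θ * D) :
    (leftKernel N w).real {l | 5 * θ * D < |(degree m (w, l) j : ℝ) - D|}
      ≤ 2 * Real.exp (-(θ ^ 2 * D / 8)) := by
  have hprob (k : Fin N) := isProbabilityMeasure_leftLaw_rightEnd hw k
  have hB := measurableSet_blockVertex m w j
  -- If `D < 0`, then `0 ≤ m ≤ θ D ≤ 0` makes the error in `hmean` vanish, so `D` would equal a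
  -- nonnegative sum.
  have hD : 0 ≤ D := by
    by_contra! h
    have := mul_nonneg hθ (neg_nonneg.2 h.le)
    have hm0 : (0 : ℝ) ≤ m := m.cast_nonneg
    have h0 : θ * D = 0 := by linarith
    have : |∑ k : Fin N, (leftLaw (rightEnd w (k + 1))).real (blockVertex m w j) - D| ≤ 0 := by
      nlinarith
    have h2 := abs_nonpos_iff.1 this
    have h3 : 0 ≤ ∑ k : Fin N, (leftLaw (rightEnd w (k + 1))).real (blockVertex m w j) :=
      Finset.sum_nonneg fun _ _ => measureReal_nonneg
    linarith
  have h := pi_measureReal_abs_sum_sub_ge_le (fun k : Fin N => leftLaw (rightEnd w (k + 1)))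
    (fun _ => (blockVertex m w j).indicator fun _ => (1 : ℝ))
    (fun k => (leftLaw (rightEnd w (k + 1))).real (blockVertex m w j))
    (fun k s _ => integrable_exp_mul_indicator hB s) (fun k s hs => mgf_indicator_le hB hs)
    hθ (by linarith)
  rw [← leftKernel_apply] at h
  set M := ∑ k : Fin N, (leftLaw (rightEnd w (k + 1))).real (blockVertex m w j)
  obtain ⟨hm1, hm2⟩ := abs_le.1 hmean
  have hθD : θ * D ≤ D / 5 := by nlinarith
  have hM1 : D / 2 ≤ M := by linarith
  have hM2 : θ * M ≤ 3 / 2 * (θ * D) := by nlinarith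
  have : IsFiniteMeasure (leftKernel N w) := inferInstance
  refine (measureReal_mono fun l hl => ?_).trans (h.trans ?_)
  -- The constant is `5 = 3/2 + 5/2 + 1`: fluctuation `θ M ≤ 3/2 θ D`, error of the mean, and right
  -- endpoints.
  · obtain ⟨h1, h2⟩ := degree_cast_mem (m := m) hw hj hjN l
    change 5 * θ * D < |(degree m (w, l) j : ℝ) - D| at hl
    change θ * M ≤ |∑ k : Fin N, (blockVertex m w j).indicator (fun _ => (1 : ℝ)) (l k) - M|
    by_contra! hlt
    obtain ⟨h3, h4⟩ := abs_lt.1 hlt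
    refine absurd hl (not_lt.2 (abs_le.2 ⟨?_, ?_⟩)) <;> linarith
  · have : θ ^ 2 * (D / 2) ≤ θ ^ 2 * M := by gcongr
    exact mul_le_mul_of_nonneg_left (Real.exp_le_exp.2 (by linarith)) zero_le_two

/-! ### Probabilities of exceptional weights -/

theorem measureReal_exists_weight_gt_le (N : ℕ) {q : ℝ} (hq : 0 ≤ q) :
    (Measure.pi fun _ : Fin (N + 1) => expMeasure 1).real {w | ∃ i, q < w i}
      ≤ (N + 1) * Real.exp (-q) := by
  have h : {w : Fin (N + 1) → ℝ | ∃ i, q < w i}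
      = ⋃ i ∈ (Finset.univ : Finset (Fin (N + 1))), Function.eval i ⁻¹' Ioi q := by
    ext w; simp
  rw [h]
  refine (measureReal_biUnion_finset_le _ _).trans ?_
  have h1 (i : Fin (N + 1)) :
      (Measure.pi fun _ : Fin (N + 1) => expMeasure 1).real (Function.eval i ⁻¹' Ioi q)
        = Real.exp (-q) := by
    rw [(measurePreserving_eval (fun _ : Fin (N + 1) => expMeasure 1) i).measureReal_preimage
      measurableSet_Ioi.nullMeasurableSet, expMeasure_one_real_Ioi hq]
  simp [h1]

theorem measureReal_weight_lt_le (N : ℕ) {y : ℝ} (hy : 0 ≤ y) :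
    (Measure.pi fun _ : Fin (N + 1) => expMeasure 1).real {w | w 0 < y} ≤ y := by
  have h : {w : Fin (N + 1) → ℝ | w 0 < y} = Function.eval 0 ⁻¹' Iio y := rfl
  rw [h, (measurePreserving_eval (fun _ : Fin (N + 1) => expMeasure 1) 0).measureReal_preimage
    measurableSet_Iio.nullMeasurableSet]
  exact expMeasure_one_real_Iio_le hy

/-- By independence the probability is a product of factors at most `x`. Applied to a block of `m`
weights it yields `x ^ m`. -/
theorem measureReal_forall_mem_weight_lt_le {N : ℕ} (s : Finset (Fin (N + 1))) {x : ℝ}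
    (hx : 0 ≤ x) :
    (Measure.pi fun _ : Fin (N + 1) => expMeasure 1).real {w | ∀ i ∈ s, w i < x} ≤ x ^ s.card := by
  classical
  have h : {w : Fin (N + 1) → ℝ | ∀ i ∈ s, w i < x}
      = univ.pi fun i => if i ∈ s then Iio x else univ := by
    ext w
    simp only [mem_univ_pi]
    refine forall_congr' fun i => ?_
    by_cases hi : i ∈ s <;> simp [hi]
  rw [h, measureReal_def, Measure.pi_pi, ENNReal.toReal_prod, ← Finset.prod_const,
    ← Finset.prod_subset (Finset.subset_univ s)]
  · refine Finset.prod_le_prod (fun _ _ => ENNReal.toReal_nonneg) fun i hi => ?_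
    rw [if_pos hi]
    exact expMeasure_one_real_Iio_le hx
  · intro i _ hi
    simp [hi]

/-- The weights are bounded by `q`, and each of the first `⌊A⌋` blocks contains a weight that is at
least `x`. -/
def regularWeights (m N : ℕ) (q A x : ℝ) : Set (Fin (N + 1) → ℝ) :=
  {w | (∀ i, w i ≤ q) ∧ ∀ j ∈ Finset.Icc 1 ⌊A⌋₊,
    ∃ i : Fin (N + 1), m * (j - 1) ≤ i ∧ (i : ℕ) < m * j ∧ x ≤ w i}

theorem measureReal_compl_regularWeights_le {m n : ℕ} {q A x : ℝ} (hq : 0 ≤ q) (hA : 0 ≤ A)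
    (hAn : A ≤ n) (hx : 0 ≤ x) :
    (Measure.pi fun _ : Fin (m * n + 1) => expMeasure 1).real (regularWeights m (m * n) q A x)ᶜ
      ≤ (m * n + 1) * Real.exp (-q) + A * x ^ m := by
  classical
  set s : ℕ → Finset (Fin (m * n + 1)) := fun j =>
    Finset.univ.filter fun i => m * (j - 1) ≤ (i : ℕ) ∧ (i : ℕ) < m * j with hs
  have hsub : (regularWeights m (m * n) q A x)ᶜ ⊆ {w | ∃ i, q < w i} ∪
      ⋃ j ∈ Finset.Icc 1 ⌊A⌋₊, {w | ∀ i ∈ s j, w i < x} := by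
    intro w hw
    by_cases h : ∃ i, q < w i
    · exact Or.inl h
    · right
      push Not at h
      by_contra hcon
      refine hw ⟨h, fun j hj => ?_⟩
      by_contra! hj'
      refine hcon (mem_biUnion (Finset.mem_coe.2 hj) fun i hi => ?_)
      obtain ⟨-, h1, h2⟩ := Finset.mem_filter.1 hi
      exact hj' i h1 h2
  have hcard : ∀ j ∈ Finset.Icc 1 ⌊A⌋₊, (s j).card = m := by
    intro j hj
    obtain ⟨hj1, hjA⟩ := Finset.mem_Icc.1 hj
    have hjn : j ≤ n := by
      have : (j : ℝ) ≤ n := ((Nat.le_floor_iff hA).1 hjA).trans hAn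
      exact_mod_cast this
    have hmjn : m * j ≤ m * n := Nat.mul_le_mul_left _ hjn
    have hm : m * j - m * (j - 1) = m := by
      obtain ⟨i, rfl⟩ := Nat.exists_eq_add_of_le' hj1
      simp [Nat.mul_succ]
    rw [← Finset.card_map Fin.valEmbedding]
    have : (s j).map Fin.valEmbedding = Finset.Ico (m * (j - 1)) (m * j) := by
      ext k
      simp only [hs, Finset.mem_map, Finset.mem_filter, Finset.mem_univ, true_and,
        Fin.valEmbedding_apply, Finset.mem_Ico]
      constructor
      · rintro ⟨i, hi, rfl⟩
        exact hi
      · intro hk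
        exact ⟨⟨k, by omega⟩, hk, rfl⟩
    rw [this, Nat.card_Ico, hm]
  calc _ ≤ (Measure.pi fun _ : Fin (m * n + 1) => expMeasure 1).real {w | ∃ i, q < w i} +
        ∑ j ∈ Finset.Icc 1 ⌊A⌋₊,
          (Measure.pi fun _ : Fin (m * n + 1) => expMeasure 1).real {w | ∀ i ∈ s j, w i < x} :=
        (measureReal_mono hsub).trans ((measureReal_union_le _ _).trans
          (add_le_add le_rfl (measureReal_biUnion_finset_le _ _)))
    _ ≤ (m * n + 1) * Real.exp (-q) + ∑ j ∈ Finset.Icc 1 ⌊A⌋₊, x ^ m := by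
        refine add_le_add ?_ (Finset.sum_le_sum fun j hj => ?_)
        · exact_mod_cast measureReal_exists_weight_gt_le (m * n) hq
        · exact (measureReal_forall_mem_weight_lt_le (s j) hx).trans_eq
            (congrArg (x ^ ·) (hcard j hj))
    _ ≤ (m * n + 1) * Real.exp (-q) + A * x ^ m := by
        rw [Finset.sum_const, Nat.card_Icc, nsmul_eq_mul, Nat.add_sub_cancel]
        have := Nat.floor_le hA
        gcongr

/-- The first weight is at least `y`, and `W_k` is close to `k` for all large `k`. -/
def concentratedWeights (N : ℕ) (q y : ℝ) : Set (Fin (N + 1) → ℝ) :=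
  {w | y ≤ w 0 ∧ ∀ k ∈ Finset.Icc 1 N, 4 * q ≤ k → |partialSum w k - k| < √(q / k) * k}

theorem measureReal_compl_concentratedWeights_le (N : ℕ) {q y : ℝ} (hq : 0 ≤ q) (hy : 0 ≤ y) :
    (Measure.pi fun _ : Fin (N + 1) => expMeasure 1).real (concentratedWeights N q y)ᶜ
      ≤ y + N * (2 * Real.exp (-(q / 4))) := by
  set t : Finset ℕ := (Finset.Icc 1 N).filter fun k => 4 * q ≤ k
  have hsub : (concentratedWeights N q y)ᶜ ⊆ {w | w 0 < y} ∪
      ⋃ k ∈ t, {w | √(q / k) * k ≤ |partialSum w k - k|} := by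
    intro w hw
    rcases lt_or_ge (w 0) y with h | h
    · exact Or.inl h
    · right
      by_contra hcon
      refine hw ⟨h, fun k hk hk4 => ?_⟩
      by_contra! hk'
      exact hcon (mem_biUnion (Finset.mem_coe.2 (Finset.mem_filter.2 ⟨hk, hk4⟩)) hk')
  have ht : (t.card : ℝ) ≤ N := by
    have := Finset.card_filter_le (Finset.Icc 1 N) fun k => 4 * q ≤ (k : ℝ)
    rw [Nat.card_Icc, Nat.add_sub_cancel] at this
    exact_mod_cast this
  calc _ ≤ (Measure.pi fun _ : Fin (N + 1) => expMeasure 1).real {w | w 0 < y} +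
        ∑ k ∈ t, (Measure.pi fun _ : Fin (N + 1) => expMeasure 1).real
          {w | √(q / k) * k ≤ |partialSum w k - k|} :=
        (measureReal_mono hsub).trans ((measureReal_union_le _ _).trans
          (add_le_add le_rfl (measureReal_biUnion_finset_le _ _)))
    _ ≤ y + ∑ k ∈ t, 2 * Real.exp (-(q / 4)) := by
        refine add_le_add (measureReal_weight_lt_le N hy) (Finset.sum_le_sum fun k hk => ?_)
        obtain ⟨hk1, hk4⟩ := Finset.mem_filter.1 hk
        obtain ⟨h1, hN⟩ := Finset.mem_Icc.1 hk1
        have hk0 : (0 : ℝ) < k := by exact_mod_cast h1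
        have hqk : q / k ≤ 1 := by
          rw [div_le_one hk0]
          linarith
        -- The relative deviation `√(q / k)` makes the Chernoff exponent `q / 4` for every `k`.
        have := measureReal_abs_partialSum_sub_ge_le (N := N) (k := k) (by omega)
          (Real.sqrt_nonneg (q / k)) (Real.sqrt_le_one.2 hqk)
        rwa [Real.sq_sqrt (by positivity), div_mul_cancel₀ _ hk0.ne'] at this
    _ ≤ y + N * (2 * Real.exp (-(q / 4))) := by
        rw [Finset.sum_const, nsmul_eq_mul]
        gcongr

/-! ### From conditional estimates to the joint law -/

/-- An event is unlikely if it is unlikely given any weights outside of an exceptional set. -/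
theorem chordLaw_real_le {N : ℕ} {S : Set ((Fin (N + 1) → ℝ) × (Fin N → ℝ))}
    (hS : MeasurableSet S) {G : Set (Fin (N + 1) → ℝ)} {c : ℝ}
    (h : ∀ w, (∀ i, 0 < w i) → w ∈ G → (leftKernel N w).real (Prod.mk w ⁻¹' S) ≤ c)
    (hc : 0 ≤ c) :
    (chordLaw N).real S
      ≤ (Measure.pi fun _ : Fin (N + 1) => expMeasure 1).real Gᶜ + c := by
  classical
  set P := Measure.pi fun _ : Fin (N + 1) => expMeasure 1
  have h1 : chordLaw N S ≤ P Gᶜ + ENNReal.ofReal c := by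
    rw [chordLaw, Measure.compProd_apply hS]
    calc ∫⁻ w, leftKernel N w (Prod.mk w ⁻¹' S) ∂P
        ≤ ∫⁻ w, (Gᶜ.indicator (fun _ => (1 : ℝ≥0∞)) w + ENNReal.ofReal c) ∂P := by
          refine lintegral_mono_ae ?_
          filter_upwards [ae_pos_weights N] with w hw
          have hk (k : Fin N) := isProbabilityMeasure_leftLaw_rightEnd hw k
          have : IsProbabilityMeasure (leftKernel N w) := by
            rw [leftKernel_apply]; infer_instance
          by_cases hG : w ∈ G
          · refine le_trans ?_ le_add_self
            rw [← ofReal_measureReal]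
            exact ENNReal.ofReal_le_ofReal (h w hw hG)
          · rw [indicator_of_mem (mem_compl hG)]
            exact prob_le_one.trans le_self_add
      _ ≤ P Gᶜ + ENNReal.ofReal c := by
          rw [lintegral_add_right _ measurable_const, lintegral_const, measure_univ, mul_one]
          gcongr
          exact (lintegral_indicator_const_le _ _).trans_eq (one_mul _)
  have h2 : chordLaw N S ≠ ∞ := measure_ne_top _ _
  rw [measureReal_def, measureReal_def, ← ENNReal.toReal_ofReal hc,
    ← ENNReal.toReal_add (measure_ne_top _ _) ENNReal.ofReal_ne_top]
  exact ENNReal.toReal_mono (ENNReal.add_ne_top.2 ⟨measure_ne_top _ _, ENNReal.ofReal_ne_top⟩) h1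

theorem measurable_degree (m N j : ℕ) :
    Measurable fun x : (Fin (N + 1) → ℝ) × (Fin N → ℝ) => degree m x j := by
  classical
  have hmem (g : (Fin (N + 1) → ℝ) × (Fin N → ℝ) → ℝ) (hg : Measurable g) :
      Measurable fun x => (blockVertex m x.1 j).indicator (fun _ => (1 : ℕ)) (g x) := by
    have hset : MeasurableSet {x : (Fin (N + 1) → ℝ) × (Fin N → ℝ) | g x ∈ blockVertex m x.1 j} := by
      have : {x : (Fin (N + 1) → ℝ) × (Fin N → ℝ) | g x ∈ blockVertex m x.1 j}
          = ⋃ i ∈ Finset.Icc (m * (j - 1) + 1) (m * j),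
            {x | rightEnd x.1 (i - 1) < g x} ∩ {x | g x ≤ rightEnd x.1 i} := by
        ext x
        simp [blockVertex, chordVertex]
      rw [this]
      exact Finset.measurableSet_biUnion _ fun i _ =>
        (measurableSet_lt ((measurable_rightEnd _).comp measurable_fst) hg).inter
          (measurableSet_le hg ((measurable_rightEnd _).comp measurable_fst))
    have e : (fun x : (Fin (N + 1) → ℝ) × (Fin N → ℝ) =>
        (blockVertex m x.1 j).indicator (fun _ => (1 : ℕ)) (g x))
        = {x : (Fin (N + 1) → ℝ) × (Fin N → ℝ) | g x ∈ blockVertex m x.1 j}.indicator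
          fun _ => 1 := by
      funext x
      by_cases hx : g x ∈ blockVertex m x.1 j
      · rw [indicator_of_mem hx, indicator_of_mem (by exact hx)]
      · rw [indicator_of_notMem hx, indicator_of_notMem (by exact hx)]
    rw [e]
    exact measurable_const.indicator hset
  unfold degree
  exact Finset.measurable_sum _ fun k _ =>
    (hmem _ ((measurable_pi_apply k).comp measurable_snd)).add
      (hmem _ ((measurable_rightEnd _).comp measurable_fst))

theorem measurable_approxDegree (m n j : ℕ) :
    Measurable fun w : Fin (m * n + 1) → ℝ => approxDegree m n w j := by
  unfold approxDegree
  exact ((measurable_partialSum _).sqrt.sub (measurable_partialSum _).sqrt).const_mul _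

/-- Since `𝒟(j)` depends on the weights only, `le_approxDegree` makes the event empty given regular
weights, and the conditional term is `c = 0`. -/
theorem chordLaw_exists_approxDegree_lt_le {m n : ℕ} (hm : 1 ≤ m) {q A x D₀ : ℝ} (hq : 0 ≤ q)
    (hA : 0 ≤ A) (hAn : A ≤ n) (hx : 0 ≤ x) (hD₀ : D₀ ≤ √(n / (A * q)) * x) :
    (chordLaw (m * n)).real {z | ∃ j ∈ Finset.Icc 1 ⌊A⌋₊, approxDegree m n z.1 j < D₀}
      ≤ (m * n + 1) * Real.exp (-q) + A * x ^ m := by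
  refine le_trans (chordLaw_real_le (G := regularWeights m (m * n) q A x) (c := 0) ?_ ?_ le_rfl) ?_
  · have : {z : (Fin (m * n + 1) → ℝ) × (Fin (m * n) → ℝ) |
        ∃ j ∈ Finset.Icc 1 ⌊A⌋₊, approxDegree m n z.1 j < D₀}
        = ⋃ j ∈ Finset.Icc 1 ⌊A⌋₊, {z | approxDegree m n z.1 j < D₀} := by
      ext z; simp
    rw [this]
    exact Finset.measurableSet_biUnion _ fun j _ =>
      measurableSet_lt ((measurable_approxDegree m n j).comp measurable_fst) measurable_const
  · intro w hw hG
    have : Prod.mk w ⁻¹' {z : (Fin (m * n + 1) → ℝ) × (Fin (m * n) → ℝ) |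
        ∃ j ∈ Finset.Icc 1 ⌊A⌋₊, approxDegree m n z.1 j < D₀} = ∅ := by
      rw [eq_empty_iff_forall_notMem]
      rintro l ⟨j, hj, hlt⟩
      obtain ⟨hj1, hjA⟩ := Finset.mem_Icc.1 hj
      exact absurd hlt (not_lt.2 (hD₀.trans (le_approxDegree hm hw hx hG.1 hj1
        ((Nat.le_floor_iff hA).1 hjA) (hG.2 j hj))))
    rw [this, measureReal_empty]
  · rw [add_zero]
    exact measureReal_compl_regularWeights_le hq hA hAn hx

/-- A bound for the probability that some degree `D(j)`, `j ≤ A`, is far from `𝒟(j)`. -/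
theorem chordLaw_exists_abs_degree_sub_gt_le {m n : ℕ} (hm : 1 ≤ m) {q y A x D₀ θ : ℝ}
    (hq : 1 ≤ q) (hy : 0 < y) (hA : 0 ≤ A) (hAn : A ≤ n) (hx : 0 ≤ x) (hθ : 0 ≤ θ)
    (hθ1 : θ ≤ 1 / 5) (hD₀ : D₀ ≤ √(n / (A * q)) * x) (hmD₀ : m ≤ θ * D₀)
    (hE : 2 * ((4 * q + 1) * (1 / √y + 1) + 2 * q * (1 + Real.log (m * n)) + 2)
      + 2 * √(m * A) ≤ 3 * θ * √(m * n)) :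
    (chordLaw (m * n)).real {z | ∃ j ∈ Finset.Icc 1 ⌊A⌋₊,
        5 * θ * approxDegree m n z.1 j < |(degree m z j : ℝ) - approxDegree m n z.1 j|}
      ≤ (m * n + 1) * Real.exp (-q) + A * x ^ m + (y + m * n * (2 * Real.exp (-(q / 4))))
        + A * (2 * Real.exp (-(θ ^ 2 * D₀ / 8))) := by
  have hq0 : 0 ≤ q := by linarith
  refine le_trans (chordLaw_real_le
    (G := regularWeights m (m * n) q A x ∩ concentratedWeights (m * n) q y)
    (c := A * (2 * Real.exp (-(θ ^ 2 * D₀ / 8)))) ?_ ?_ (by positivity)) ?_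
  · have : {z : (Fin (m * n + 1) → ℝ) × (Fin (m * n) → ℝ) | ∃ j ∈ Finset.Icc 1 ⌊A⌋₊,
        5 * θ * approxDegree m n z.1 j < |(degree m z j : ℝ) - approxDegree m n z.1 j|}
        = ⋃ j ∈ Finset.Icc 1 ⌊A⌋₊, {z | 5 * θ * approxDegree m n z.1 j
          < |(degree m z j : ℝ) - approxDegree m n z.1 j|} := by
      ext z; simp
    rw [this]
    refine Finset.measurableSet_biUnion _ fun j _ => ?_
    have h1 : Measurable fun z : (Fin (m * n + 1) → ℝ) × (Fin (m * n) → ℝ) =>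
        approxDegree m n z.1 j := (measurable_approxDegree m n j).comp measurable_fst
    have h2 : Measurable fun z : (Fin (m * n + 1) → ℝ) × (Fin (m * n) → ℝ) =>
        (degree m z j : ℝ) := measurable_from_top.comp (measurable_degree m (m * n) j)
    exact measurableSet_lt (h1.const_mul _) (h2.sub h1).abs
  · rintro w hw ⟨hG1, hG2⟩
    have hbound : ∀ j ∈ Finset.Icc 1 ⌊A⌋₊, (leftKernel (m * n) w).real
        {l | 5 * θ * approxDegree m n w j < |(degree m (w, l) j : ℝ) - approxDegree m n w j|}
        ≤ 2 * Real.exp (-(θ ^ 2 * D₀ / 8)) := by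
      intro j hj
      obtain ⟨hj1, hjA⟩ := Finset.mem_Icc.1 hj
      have hjA' := (Nat.le_floor_iff hA).1 hjA
      have hjn : j ≤ n := by exact_mod_cast hjA'.trans hAn
      have hD := hD₀.trans (le_approxDegree hm hw hx hG1.1 hj1 hjA' (hG1.2 j hj))
      have hmD : m ≤ θ * approxDegree m n w j := hmD₀.trans (by gcongr)
      have hmean := abs_sum_leftLaw_blockVertex_sub_approxDegree_le hm hw hj1 hjn (θ := θ)
        (fun u hu => abs_sum_one_div_sqrt_partialSum_sub_le hw hq hy hG2.1 hG2.2 hu) ?_ hmD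
      · refine (leftKernel_abs_degree_sub_gt_le hw hj1 (Nat.mul_le_mul_left _ hjn) hθ hθ1 hmD
          hmean).trans ?_
        gcongr
      · refine le_trans ?_ hE
        push_cast
        gcongr
    have hset : Prod.mk w ⁻¹' {z : (Fin (m * n + 1) → ℝ) × (Fin (m * n) → ℝ) |
        ∃ j ∈ Finset.Icc 1 ⌊A⌋₊,
        5 * θ * approxDegree m n z.1 j < |(degree m z j : ℝ) - approxDegree m n z.1 j|}
        = ⋃ j ∈ Finset.Icc 1 ⌊A⌋₊, {l | 5 * θ * approxDegree m n w j
          < |(degree m (w, l) j : ℝ) - approxDegree m n w j|} := by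
      ext l; simp
    rw [hset]
    refine (measureReal_biUnion_finset_le _ _).trans ((Finset.sum_le_sum hbound).trans ?_)
    rw [Finset.sum_const, Nat.card_Icc, nsmul_eq_mul, Nat.add_sub_cancel]
    have := Nat.floor_le hA
    gcongr
  · refine add_le_add ?_ le_rfl
    rw [compl_inter]
    refine (measureReal_union_le _ _).trans (add_le_add
      (measureReal_compl_regularWeights_le hq0 hA hAn hx) ?_)
    exact_mod_cast measureReal_compl_concentratedWeights_le (m * n) hq0 hy.le

/-! ### Asymptotics in powers of `n` -/

theorem eventually_const_mul_rpow_le (C : ℝ) {α β : ℝ} (h : α < β) :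
    ∀ᶠ n : ℕ in atTop, C * (n : ℝ) ^ α ≤ (n : ℝ) ^ β := by
  filter_upwards [((tendsto_rpow_atTop (sub_pos.2 h)).comp
    tendsto_natCast_atTop_atTop).eventually_ge_atTop C, eventually_ge_atTop 1] with n hC hn
  have hn0 : (0 : ℝ) < n := by exact_mod_cast hn
  calc C * (n : ℝ) ^ α ≤ (n : ℝ) ^ (β - α) * (n : ℝ) ^ α :=
        mul_le_mul_of_nonneg_right hC (by positivity)
    _ = (n : ℝ) ^ β := by rw [← Real.rpow_add hn0, sub_add_cancel]

theorem eventually_exp_neg_rpow_le {c η : ℝ} (hc : 0 < c) (hη : 0 < η) (s : ℝ) :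
    ∀ᶠ n : ℕ in atTop, Real.exp (-(c * (n : ℝ) ^ η)) ≤ (n : ℝ) ^ s := by
  have h1 := (isLittleO_exp_neg_mul_rpow_atTop hc (s / η)).comp_tendsto
    ((tendsto_rpow_atTop hη).comp tendsto_natCast_atTop_atTop)
  filter_upwards [h1.bound one_pos] with n hn
  simp only [Function.comp, one_mul, Real.norm_eq_abs] at hn
  rw [← Real.rpow_mul n.cast_nonneg, mul_div_cancel₀ _ hη.ne', ← neg_mul_eq_neg_mul] at *
  exact (le_abs_self _).trans (hn.trans_eq (abs_of_nonneg (by positivity)))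

/-- This treats `regularWeights` with `q = n ^ η`, `A = n ^ a` and `x = n ^ (β + η - (1 - a - η) /
2)`. By `sqrt_div_mul_rpow`, this `x` is the one for which `√(n / (A q)) x = n ^ (β + η)`. Part (1)
uses `β = 2δ` and part (2) uses `β = b`. -/
theorem eventually_weights_bound_le (m : ℕ) {a β η Δ : ℝ} (hη : 0 < η)
    (hΔ : a + m * (β + η - (1 - a - η) / 2) < -Δ) {c : ℝ} (hc : 0 < c) :
    ∀ᶠ n : ℕ in atTop, ((m : ℝ) * n + 1) * Real.exp (-(n : ℝ) ^ η)
      + (n : ℝ) ^ a * ((n : ℝ) ^ (β + η - (1 - a - η) / 2)) ^ m ≤ c * (n : ℝ) ^ (-Δ) := by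
  filter_upwards [eventually_const_mul_rpow_le (2 / c) hΔ,
    eventually_exp_neg_rpow_le one_pos hη (-Δ - 2),
    eventually_const_mul_rpow_le ((m + 1) * (2 / c)) (show -Δ - 1 < -Δ by linarith),
    eventually_ge_atTop 1] with n h1 h2 h3 hn
  have hn1 : (1 : ℝ) ≤ n := by exact_mod_cast hn
  have hn0 : (0 : ℝ) < n := by linarith
  rw [one_mul] at h2
  rw [← Real.rpow_natCast, ← Real.rpow_mul hn0.le, ← Real.rpow_add hn0, mul_comm _ (m : ℝ)]
  have h4 : ((m : ℝ) * n + 1) * Real.exp (-(n : ℝ) ^ η) ≤ (m + 1) * (n : ℝ) ^ (-Δ - 1) := by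
    calc _ ≤ ((m : ℝ) * n + n) * (n : ℝ) ^ (-Δ - 2) := by gcongr
      _ = (m + 1) * ((n : ℝ) ^ (-Δ - 2) * n) := by ring
      _ = _ := by
          rw [← Real.rpow_add_one hn0.ne']
          ring_nf
  have e1 : c / 2 * ((m + 1) * (2 / c) * (n : ℝ) ^ (-Δ - 1)) = (m + 1) * (n : ℝ) ^ (-Δ - 1) := by
    field_simp
  have e2 (z : ℝ) : c / 2 * (2 / c * z) = z := by field_simp
  have h5 := mul_le_mul_of_nonneg_left h1 (show 0 ≤ c / 2 by linarith)
  have h6 := mul_le_mul_of_nonneg_left h3 (show 0 ≤ c / 2 by linarith)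
  rw [e1] at h6
  rw [e2] at h5
  linarith

theorem sqrt_div_mul_rpow {n : ℕ} (hn : 1 ≤ n) (a β η : ℝ) :
    √((n : ℝ) / ((n : ℝ) ^ a * (n : ℝ) ^ η)) * (n : ℝ) ^ (β + η - (1 - a - η) / 2)
      = (n : ℝ) ^ (β + η) := by
  have hn0 : (0 : ℝ) < n := by exact_mod_cast hn
  have e : (n : ℝ) / ((n : ℝ) ^ a * (n : ℝ) ^ η) = (n : ℝ) ^ (1 - a - η) := by
    rw [Real.rpow_sub hn0, Real.rpow_sub hn0, Real.rpow_one, div_div]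
  rw [e, Real.sqrt_eq_rpow, ← Real.rpow_mul hn0.le, ← Real.rpow_add hn0]
  congr 1; ring

theorem one_sub_le_measureReal {Ω : Type*} [MeasurableSpace Ω] {μ : Measure Ω}
    [IsProbabilityMeasure μ] {S T : Set Ω} {r : ℝ} (h : Sᶜ ⊆ T) (hT : μ.real T ≤ r) :
    1 - r ≤ μ.real S := by
  have h1 : μ.real univ ≤ μ.real S + μ.real Sᶜ := by
    rw [← union_compl_self S]
    exact measureReal_union_le _ _
  rw [probReal_univ] at h1
  linarith [measureReal_mono (μ := μ) h]

/-- With `q = n ^ η`, the choice `y = n ^ (-(1 - 2δ - 4η))` gives `q / √y = n ^ (1/2 - δ - η)`, just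
below `n ^ (-δ) √n`. The term `√(m n ^ a)` accounts for the missing indices `k < mj`. -/
theorem eventually_mean_error_le (m : ℕ) (hm : 1 ≤ m) {a δ η : ℝ} (hη : 0 < η)
    (ha : a / 2 < 1 / 2 - δ) (hηδ : 2 * η < 1 / 2 - δ) :
    ∀ᶠ n : ℕ in atTop,
      2 * ((4 * (n : ℝ) ^ η + 1) * (1 / √((n : ℝ) ^ (-(1 - 2 * δ - 4 * η))) + 1)
        + 2 * (n : ℝ) ^ η * (1 + Real.log (m * n)) + 2) + 2 * √(m * (n : ℝ) ^ a)
        ≤ 3 * (n : ℝ) ^ (-δ) * √(m * n) := by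
  have hlog : ∀ᶠ n : ℕ in atTop, Real.log n ≤ (n : ℝ) ^ (η / 2) := by
    have h1 := (isLittleO_log_rpow_atTop (half_pos hη)).comp_tendsto tendsto_natCast_atTop_atTop
    filter_upwards [h1.bound one_pos] with n hn
    simp only [Function.comp, one_mul, Real.norm_eq_abs] at hn
    exact (le_abs_self _).trans (hn.trans_eq (abs_of_nonneg (by positivity)))
  filter_upwards [hlog, eventually_const_mul_rpow_le (2 + Real.log m) (half_lt_self hη),
    eventually_const_mul_rpow_le 40 (show 1 / 2 - δ - η < 1 / 2 - δ by linarith),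
    eventually_const_mul_rpow_le 8 (show 2 * η < 1 / 2 - δ from hηδ),
    eventually_const_mul_rpow_le 8 (show 0 < 1 / 2 - δ by linarith),
    eventually_const_mul_rpow_le (4 * √m) ha, eventually_ge_atTop 1]
    with n h1 h2 h3 h4 h5 h6 hn
  have hn1 : (1 : ℝ) ≤ n := by exact_mod_cast hn
  have hn0 : (0 : ℝ) < n := by linarith
  have hm1 : (1 : ℝ) ≤ m := by exact_mod_cast hm
  have hq : 1 ≤ (n : ℝ) ^ η := Real.one_le_rpow hn1 hη.le
  have hq2 : 1 ≤ (n : ℝ) ^ (η / 2) := Real.one_le_rpow hn1 (half_pos hη).le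
  have hlogm : 0 ≤ Real.log m := Real.log_nonneg hm1
  have ey : 1 / √((n : ℝ) ^ (-(1 - 2 * δ - 4 * η))) = (n : ℝ) ^ (1 / 2 - δ - 2 * η) := by
    rw [Real.sqrt_eq_rpow, ← Real.rpow_mul hn0.le, one_div, ← Real.rpow_neg hn0.le]
    congr 1; ring
  have hy1 : 1 ≤ (n : ℝ) ^ (1 / 2 - δ - 2 * η) := Real.one_le_rpow hn1 (by linarith)
  have t1 : (4 * (n : ℝ) ^ η + 1) * ((n : ℝ) ^ (1 / 2 - δ - 2 * η) + 1)
      ≤ 10 * (n : ℝ) ^ (1 / 2 - δ - η) := by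
    calc _ ≤ (5 * (n : ℝ) ^ η) * (2 * (n : ℝ) ^ (1 / 2 - δ - 2 * η)) := by
          gcongr <;> linarith
      _ = 10 * ((n : ℝ) ^ η * (n : ℝ) ^ (1 / 2 - δ - 2 * η)) := by ring
      _ = _ := by
          rw [← Real.rpow_add hn0]
          ring_nf
  have t2 : 2 * (n : ℝ) ^ η * (1 + Real.log (m * n)) ≤ 2 * (n : ℝ) ^ (2 * η) := by
    have h7 : 1 + Real.log (m * n) ≤ (n : ℝ) ^ η := by
      rw [Real.log_mul (by linarith) hn0.ne']
      nlinarith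
    calc _ ≤ 2 * (n : ℝ) ^ η * (n : ℝ) ^ η := by gcongr
      _ = _ := by rw [mul_assoc, ← Real.rpow_add hn0, two_mul η]
  have t3 : √(m * (n : ℝ) ^ a) = √m * (n : ℝ) ^ (a / 2) := by
    rw [Real.sqrt_mul (by linarith), Real.sqrt_eq_rpow ((n : ℝ) ^ a), ← Real.rpow_mul hn0.le]
    ring_nf
  have t4 : (n : ℝ) ^ (1 / 2 - δ) ≤ (n : ℝ) ^ (-δ) * √(m * n) := by
    have : √(n : ℝ) ≤ √(m * n) := Real.sqrt_le_sqrt (by nlinarith)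
    calc _ = (n : ℝ) ^ (-δ) * √n := by
          rw [Real.sqrt_eq_rpow, ← Real.rpow_add hn0]
          ring_nf
      _ ≤ _ := by gcongr
  rw [Real.rpow_zero] at h5
  rw [ey, t3]
  -- Four contributions, each at most `n ^ (1/2 - δ) / 2`, fit below the factor `3`.
  linarith

/-! ### The uniform estimates for the first `⌊n ^ a⌋` degrees -/

/-- The degrees of the first `⌊n ^ a⌋` vertices are uniformly approximated by `𝒟`. -/
theorem eventually_chordLaw_abs_degree_sub_le {m : ℕ} (hm : 1 ≤ m) {a δ Δ : ℝ} (ha : 0 < a)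
    (hδ : 0 < δ) (hδa : δ < (1 - a * (m + 2) / m) / 4)
    (hΔ : Δ < min ((1 - a) / 2 - δ) (m / 2 * (1 - a * (m + 2) / m) - 2 * m * δ)) :
    ∀ᶠ n : ℕ in atTop,
      1 - (n : ℝ) ^ (-Δ) ≤ (chordLaw (m * n)).real
        {x | ∀ j ∈ Finset.Icc 1 ⌊(n : ℝ) ^ a⌋₊,
          |(degree m x j : ℝ) - approxDegree m n x.1 j|
            ≤ 5 * (n : ℝ) ^ (-δ) * approxDegree m n x.1 j} := by
  have hm0 : (0 : ℝ) < m := by exact_mod_cast hm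
  obtain ⟨hΔ1, hΔ2⟩ := lt_min_iff.1 hΔ
  have e1 : a * (m + 2) / m = a + 2 * a / m := by field_simp
  have e2 : (m : ℝ) / 2 * (1 - a * (m + 2) / m) - 2 * m * δ
      = m / 2 - a * m / 2 - a - 2 * m * δ := by field_simp; ring
  have ham : 0 < 2 * a / m := by positivity
  rw [e1] at hδa
  rw [e2] at hΔ2
  -- The second condition makes `y = n ^ (-(1 - 2δ - 4η))` negligible against `n ^ (-Δ)`, the third
  -- controls the error of the mean, and the last does the same as the second for `A x ^ m`, whose
  -- exponent contains `m (η + η / 2)`.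
  have hη : ∃ η : ℝ, 0 < η ∧ 4 * η < 1 - 2 * δ - Δ ∧ 2 * η < 1 / 2 - δ ∧
      3 * m / 2 * η < m / 2 - a * m / 2 - a - 2 * m * δ - Δ := by
    have c1 : 0 < (1 - 2 * δ - Δ) / 4 := by linarith
    have c2 : 0 < (1 / 2 - δ) / 2 := by linarith
    have c3 : 0 < (m / 2 - a * m / 2 - a - 2 * m * δ - Δ) / (3 * m / 2) := by
      apply div_pos <;> linarith
    obtain ⟨η, h0, h1⟩ := exists_between (lt_min c1 (lt_min c2 c3))
    obtain ⟨h2, h3⟩ := lt_min_iff.1 h1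
    obtain ⟨h3, h4⟩ := lt_min_iff.1 h3
    refine ⟨η, h0, by linarith, by linarith, ?_⟩
    rwa [lt_div_iff₀' (by positivity)] at h4
  obtain ⟨η, hη, hη1, hη2, hη3⟩ := hη
  have hweights : a + m * (2 * δ + η - (1 - a - η) / 2) < -Δ := by linarith
  filter_upwards [eventually_weights_bound_le m hη hweights (show (0 : ℝ) < 1 / 4 by norm_num),
    eventually_mean_error_le m hm (a := a) hη (by linarith) hη2,
    eventually_const_mul_rpow_le 5 (show -δ < 0 by linarith),
    eventually_const_mul_rpow_le m (show 0 < δ + η by linarith),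
    eventually_const_mul_rpow_le 1 (show a < 1 by linarith),
    eventually_const_mul_rpow_le 4 (show -(1 - 2 * δ - 4 * η) < -Δ by linarith),
    eventually_const_mul_rpow_le (8 * m) (show -Δ - 1 < -Δ by linarith),
    eventually_exp_neg_rpow_le (show (0 : ℝ) < 1 / 4 by norm_num) hη (-Δ - 2),
    eventually_exp_neg_rpow_le (show (0 : ℝ) < 1 / 8 by norm_num) hη (-Δ - 2),
    eventually_const_mul_rpow_le 8 (show a + (-Δ - 2) < -Δ by linarith),
    eventually_ge_atTop 1] with n h1 h2 h3 h4 h5 h6 h7 h8 h9 h10 hn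
  have hn1 : (1 : ℝ) ≤ n := by exact_mod_cast hn
  have hn0 : (0 : ℝ) < n := by linarith
  rw [Real.rpow_zero] at h3 h4
  rw [one_mul, Real.rpow_one] at h5
  have hD₀ := sqrt_div_mul_rpow hn a (2 * δ) η
  -- Here `θ = n ^ (-δ)` and `D₀ = n ^ (2δ + η)`. Thus `θ² D₀ = n ^ η` makes the Chernoff term decay
  -- faster than any power, and `θ D₀ = n ^ (δ + η)` eventually exceeds `m`. Each of the four groups
  -- of failure probabilities receives a quarter of `n ^ (-Δ)`.
  have key := chordLaw_exists_abs_degree_sub_gt_le hm (Real.one_le_rpow hn1 hη.le)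
    (Real.rpow_pos_of_pos hn0 (-(1 - 2 * δ - 4 * η))) (Real.rpow_nonneg hn0.le a) h5
    (Real.rpow_nonneg hn0.le _) (Real.rpow_nonneg hn0.le (-δ)) (by linarith) hD₀.ge
    (by
      rw [← Real.rpow_add hn0, show -δ + (2 * δ + η) = δ + η by ring]
      linarith) h2
  refine one_sub_le_measureReal (fun z hz => ?_) (key.trans ?_)
  · by_contra hcon
    refine hz fun j hj => ?_
    by_contra! hlt
    exact hcon ⟨j, hj, hlt⟩
  · have t1 : (m : ℝ) * n * (2 * Real.exp (-((n : ℝ) ^ η / 4))) ≤ 1 / 4 * (n : ℝ) ^ (-Δ) := by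
      calc (m : ℝ) * n * (2 * Real.exp (-((n : ℝ) ^ η / 4)))
          = 2 * m * n * Real.exp (-(1 / 4 * (n : ℝ) ^ η)) := by ring_nf
        _ ≤ 2 * m * n * (n : ℝ) ^ (-Δ - 2) := by gcongr
        _ = 2 * m * ((n : ℝ) ^ (-Δ - 2) * n) := by ring
        _ = 2 * m * (n : ℝ) ^ (-Δ - 1) := by
            rw [← Real.rpow_add_one hn0.ne']
            ring_nf
        _ ≤ _ := by linarith
    have t2 : (n : ℝ) ^ a * (2 * Real.exp (-(((n : ℝ) ^ (-δ)) ^ 2 * (n : ℝ) ^ (2 * δ + η) / 8)))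
        ≤ 1 / 4 * (n : ℝ) ^ (-Δ) := by
      have e : ((n : ℝ) ^ (-δ)) ^ 2 * (n : ℝ) ^ (2 * δ + η) = (n : ℝ) ^ η := by
        rw [← Real.rpow_natCast, ← Real.rpow_mul hn0.le, ← Real.rpow_add hn0]
        push_cast
        ring_nf
      calc (n : ℝ) ^ a * (2 * Real.exp (-(((n : ℝ) ^ (-δ)) ^ 2 * (n : ℝ) ^ (2 * δ + η) / 8)))
          = 2 * ((n : ℝ) ^ a * Real.exp (-(1 / 8 * (n : ℝ) ^ η))) := by
            rw [e]; ring_nf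
        _ ≤ 2 * ((n : ℝ) ^ a * (n : ℝ) ^ (-Δ - 2)) := by gcongr
        _ ≤ _ := by
            rw [← Real.rpow_add hn0]
            linarith
    linarith

/-- The degrees of the first `⌊n ^ a⌋` vertices all exceed `n ^ b`. -/
theorem eventually_chordLaw_lt_degree {m : ℕ} (hm : 1 ≤ m) {a δ b Δ Δ₁ : ℝ} (ha : 0 < a)
    (hδ : 0 < δ) (hδa : δ < (1 - a * (m + 2) / m) / 4)
    (hΔ : Δ < min ((1 - a) / 2 - δ) (m / 2 * (1 - a * (m + 2) / m) - 2 * m * δ))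
    (hΔ₁ : Δ₁ < min Δ (m * ((1 - a * (m + 2) / m) / 2 - b))) :
    ∀ᶠ n : ℕ in atTop,
      1 - (n : ℝ) ^ (-Δ₁) ≤ (chordLaw (m * n)).real
        {x | ∀ j ∈ Finset.Icc 1 ⌊(n : ℝ) ^ a⌋₊, (n : ℝ) ^ b < (degree m x j : ℝ)} := by
  have hm0 : (0 : ℝ) < m := by exact_mod_cast hm
  obtain ⟨hΔ1, hΔ2⟩ := lt_min_iff.1 hΔ₁
  have e1 : a * (m + 2) / m = a + 2 * a / m := by field_simp
  have e2 : (m : ℝ) * ((1 - a * (m + 2) / m) / 2 - b) = m / 2 - a * m / 2 - a - m * b := by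
    field_simp; ring
  have ham : 0 < 2 * a / m := by positivity
  rw [e2] at hΔ2
  have hη : ∃ η : ℝ, 0 < η ∧ 3 * m / 2 * η < m / 2 - a * m / 2 - a - m * b - Δ₁ := by
    obtain ⟨η, h0, h1⟩ := exists_between (show
      0 < (m / 2 - a * m / 2 - a - m * b - Δ₁) / (3 * m / 2) by apply div_pos <;> linarith)
    exact ⟨η, h0, by rwa [lt_div_iff₀' (by positivity)] at h1⟩
  obtain ⟨η, hη, hη1⟩ := hη
  have hweights : a + m * (b + η - (1 - a - η) / 2) < -Δ₁ := by linarith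
  filter_upwards [eventually_chordLaw_abs_degree_sub_le hm ha hδ hδa hΔ,
    eventually_weights_bound_le m hη hweights (show (0 : ℝ) < 1 / 2 by norm_num),
    eventually_const_mul_rpow_le 10 (show -δ < 0 by linarith),
    eventually_const_mul_rpow_le 1 (show a < 1 by linarith),
    eventually_const_mul_rpow_le 2 (show -Δ < -Δ₁ by linarith),
    eventually_const_mul_rpow_le 3 (show b < b + η by linarith),
    eventually_ge_atTop 1] with n h1 h2 h3 h4 h5 h6 hn
  have hn1 : (1 : ℝ) ≤ n := by exact_mod_cast hn
  have hn0 : (0 : ℝ) < n := by linarith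
  rw [Real.rpow_zero] at h3
  rw [one_mul, Real.rpow_one] at h4
  have key := chordLaw_exists_approxDegree_lt_le hm (Real.rpow_nonneg hn0.le η)
    (Real.rpow_nonneg hn0.le a) h4 (Real.rpow_nonneg hn0.le _) (sqrt_div_mul_rpow hn a b η).ge
  set S := {x : (Fin (m * n + 1) → ℝ) × (Fin (m * n) → ℝ) |
    ∀ j ∈ Finset.Icc 1 ⌊(n : ℝ) ^ a⌋₊, |(degree m x j : ℝ) - approxDegree m n x.1 j|
      ≤ 5 * (n : ℝ) ^ (-δ) * approxDegree m n x.1 j}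
  set T := {z : (Fin (m * n + 1) → ℝ) × (Fin (m * n) → ℝ) |
    ∃ j ∈ Finset.Icc 1 ⌊(n : ℝ) ^ a⌋₊, approxDegree m n z.1 j < (n : ℝ) ^ (b + η)}
  set U := {x : (Fin (m * n + 1) → ℝ) × (Fin (m * n) → ℝ) |
    ∀ j ∈ Finset.Icc 1 ⌊(n : ℝ) ^ a⌋₊, (n : ℝ) ^ b < (degree m x j : ℝ)}
  have hsub : S ⊆ U ∪ T := by
    intro z hz
    by_cases hT : z ∈ T
    · exact Or.inr hT
    · refine Or.inl fun j hj => ?_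
      have hD : (n : ℝ) ^ (b + η) ≤ approxDegree m n z.1 j := by
        by_contra! hlt
        exact hT ⟨j, hj, hlt⟩
      have hb : 0 < (n : ℝ) ^ b := Real.rpow_pos_of_pos hn0 b
      -- Since `5 n ^ (-δ) ≤ 1 / 2`, the degree is at least `𝒟(j) / 2 ≥ n ^ (b + η) / 2 ≥ 3/2 n ^
      -- b`.
      have h7 := (abs_le.1 (hz j hj)).1
      nlinarith
  have h8 := (measureReal_mono hsub (μ := chordLaw (m * n))).trans (measureReal_union_le _ _)
  linarith

end PairingModel

theorem mainTheorem1 (m : ℕ) (hm : 1 ≤ m) :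
    (∀ a δ : ℝ, 0 < a → a < (m : ℝ) / (m + 2) →
      0 < δ → δ < (1 - a * (m + 2) / m) / 4 →
      -- (1): uniform approximation of the first `⌊n ^ a⌋` degrees
      (∃ C : ℝ, 0 < C ∧
        ∀ Δ : ℝ, Δ < min ((1 - a) / 2 - δ) (m / 2 * (1 - a * (m + 2) / m) - 2 * m * δ) →
        ∀ᶠ n : ℕ in atTop,
          1 - (n : ℝ) ^ (-Δ) ≤ (PairingModel.chordLaw (m * n)).real
            {x | ∀ j ∈ Finset.Icc 1 ⌊(n : ℝ) ^ a⌋₊,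
              |(PairingModel.degree m x j : ℝ) - PairingModel.approxDegree m n x.1 j|
                ≤ C * (n : ℝ) ^ (-δ) * PairingModel.approxDegree m n x.1 j}) ∧
      -- (2): lower bound for the minimum of the first `⌊n ^ a⌋` degrees
      (∀ b : ℝ, b < (1 - a * (m + 2) / m) / 2 →
        ∀ Δ : ℝ, Δ < min ((1 - a) / 2 - δ) (m / 2 * (1 - a * (m + 2) / m) - 2 * m * δ) →
        ∀ Δ₁ : ℝ, Δ₁ < min Δ (m * ((1 - a * (m + 2) / m) / 2 - b)) →
        ∀ᶠ n : ℕ in atTop,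
          1 - (n : ℝ) ^ (-Δ₁) ≤ (PairingModel.chordLaw (m * n)).real
            {x | ∀ j ∈ Finset.Icc 1 ⌊(n : ℝ) ^ a⌋₊,
              (n : ℝ) ^ b < (PairingModel.degree m x j : ℝ)})) ∧
    -- (3): the whp lower bound for the first `n ^ (m / (m + 2) - ε)` degrees
    (∀ ε ε' : ℝ, 0 < ε' → ε' < ε → ε < (m : ℝ) / (m + 2) →
      Tendsto (fun n : ℕ => (PairingModel.chordLaw (m * n)).real
        {x | ∀ j ∈ Finset.Icc 1 ⌊(n : ℝ) ^ ((m : ℝ) / (m + 2) - ε)⌋₊,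
          (n : ℝ) ^ (ε' * (m + 2) / (2 * m)) ≤ (PairingModel.degree m x j : ℝ)})
        atTop (𝓝 1)) := by
  have hm0 : (0 : ℝ) < m := by exact_mod_cast hm
  refine ⟨fun a δ ha _ hδ hδa => ⟨⟨5, by norm_num, fun Δ hΔ =>
    PairingModel.eventually_chordLaw_abs_degree_sub_le hm ha hδ hδa hΔ⟩, fun b _ Δ hΔ Δ₁ hΔ₁ =>
    PairingModel.eventually_chordLaw_lt_degree hm ha hδ hδa hΔ hΔ₁⟩, fun ε ε' hε' hεε' hε => ?_⟩
  set a : ℝ := (m : ℝ) / (m + 2) - ε with ha_def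
  have ha : 0 < a := sub_pos.2 hε
  have e : 1 - a * (m + 2) / m = ε * (m + 2) / m := by
    rw [ha_def]; field_simp; ring
  have hgap : 0 < 1 - a * (m + 2) / m := by
    rw [e]
    have := hε'.trans hεε'
    positivity
  have hgap' : a * (m + 2) / m = a + 2 * a / m := by field_simp
  have ham : 0 < 2 * a / m := by positivity
  have hb : ε' * (m + 2) / (2 * m) < (1 - a * (m + 2) / m) / 2 := by
    rw [e, div_div, mul_comm (m : ℝ) 2]
    gcongr
  set g : ℝ := 1 - a * (m + 2) / m with hg
  -- Any positive rate suffices. The choice `δ = g / 8`, half the allowed maximum, keeps both bounds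
  -- on `Δ` positive, because `g < 1 - a`; and `ε' < ε` leaves room for `Δ₁`.
  obtain ⟨Δ, hΔ0, hΔ⟩ := exists_between (show
      0 < min ((1 - a) / 2 - g / 8) (m / 2 * g - 2 * m * (g / 8)) by
    refine lt_min (by linarith) ?_
    have := mul_pos hm0 hgap
    linarith)
  obtain ⟨Δ₁, hΔ₁0, hΔ₁⟩ := exists_between (show
      0 < min Δ (m * (g / 2 - ε' * (m + 2) / (2 * m))) from
    lt_min hΔ0 (mul_pos hm0 (by linarith)))
  have hev := PairingModel.eventually_chordLaw_lt_degree hm ha (show 0 < g / 8 by linarith)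
    (show g / 8 < g / 4 by linarith) hΔ hΔ₁
  have hlim : Tendsto (fun n : ℕ => 1 - (n : ℝ) ^ (-Δ₁)) atTop (𝓝 1) := by
    simpa using ((tendsto_rpow_neg_atTop hΔ₁0).comp tendsto_natCast_atTop_atTop).const_sub 1
  refine tendsto_of_tendsto_of_tendsto_of_le_of_le' hlim tendsto_const_nhds ?_
    (Eventually.of_forall fun n => measureReal_le_one)
  filter_upwards [hev] with n hn
  exact hn.trans (measureReal_mono fun x hx j hj => (hx j hj).le)
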